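/- Let $(X_n)_{n\ge 1}$ be independent random variables on a probability space with $\mathbb P(X_n=1)=\mathbb P(X_n=-1)=1/2$ for every $n$, and for $\sigma>1/2$ let $$F(\sigma)=\sum_{n=1}^\infty \frac{X_n}{n^{\sigma}}=\lim_{N\to\infty}\sum_{n=1}^N\frac{X_n}{n^\sigma}.$$ Almost surely this series converges for all $\sigma>1/2$ simultaneously; moreover $\mathbb E F(\sigma)^2<\infty$ for every $\sigma>1/2$, and $(2\sigma-1)\,\mathbb E F(\sigma)^2\to 1$ as $\sigma\to 1/2^+$. Almost surely, $$\limsup_{\sigma\to 1/2^+}\frac{F(\sigma)}{\sqrt{2\,\mathbb E F(\sigma)^2\,\log\log \mathbb E F(\sigma)^2}}=1 \qquad\text{and}\qquad \limsup_{\sigma\to 1/2^+}\frac{F(\sigma)}{\sqrt{\frac{2}{2\sigma-1}\log\log\frac{1}{2\sigma-1}}}=1,$$ and almost surely the lower limits ($\liminf_{\sigma\to1/2^+}$) of the same two quotients are equal to $-1$. -/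

import Mathlib

open MeasureTheory ProbabilityTheory Filter Topology

namespace RandomDirichlet

/-- `X 0, X 1, X 2, …` are i.i.d. Rademacher signs. They stand for `X₁, X₂, X₃, …`. -/
structure IsRademacher {Ω : Type*} [MeasurableSpace Ω] (P : Measure Ω) (X : ℕ → Ω → ℝ) : Prop where
  measurable : ∀ n, Measurable (X n)
  indep : iIndepFun X P
  prob_one : ∀ n, P {ω | X n ω = 1} = 1 / 2
  prob_neg_one : ∀ n, P {ω | X n ω = -1} = 1 / 2

/-- The partial sum of the first `N` terms, `∑_{m=1}^N X_m m^{-σ}`, with `m = n + 1`. -/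
noncomputable def partialSum {Ω : Type*} (X : ℕ → Ω → ℝ) (N : ℕ) (σ : ℝ) (ω : Ω) : ℝ :=
  ∑ n ∈ Finset.range N, X n ω / ((n : ℝ) + 1) ^ σ

/-- `F(σ) = ∑_{m=1}^∞ X_m m^{-σ}`, the limit of the partial sums (the series need not converge
absolutely). -/
noncomputable def F {Ω : Type*} (X : ℕ → Ω → ℝ) (σ : ℝ) (ω : Ω) : ℝ :=
  limUnder atTop (fun N : ℕ => partialSum X N σ ω)

/-- The second moment `𝔼 F(σ)²`. -/
noncomputable def secondMoment {Ω : Type*} [MeasurableSpace Ω] (P : Measure Ω) (X : ℕ → Ω → ℝ)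
    (σ : ℝ) : ℝ :=
  ∫ ω, F X σ ω ^ 2 ∂P

/-- The iterated-logarithm normaliser `√(2 v log log v)`. -/
noncomputable def lilNorm (v : ℝ) : ℝ :=
  √(2 * v * Real.log (Real.log v))

end RandomDirichlet

/-! Put `w = 1/(2σ-1)`. The variance of `F(σ)` is `∑ m^{-2σ}`, which lies between `w` and `w + 1`,
so a law of the iterated logarithm should hold with variance `w`. Since `lilNorm (c w) / lilNorm w →
√c`, either normaliser may be used.

Upper bound. Take `w = θ^k`. Doob's inequality applied to `exp (λ S_N)` gives a subgaussian bound
for the maximum of all partial sums at one exponent (`measure_exists_le_wsum`); at level `θ *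
lilNorm (θ^k)` it is of order `k^{-θ}`, so Borel–Cantelli applies. To pass between the chosen
exponents no chaining is needed: for `τ ≥ σ` the weights `m^{-(τ-σ)}` decrease from 1, so by Abel
summation a bound on all partial sums at `σ` also bounds `F(τ)` (`F_le_of_wsum_le`).

Lower bound. At a given `w` the variance sits on the indices with `log n` comparable to `w`. Take
`w_k = m^{2k+1}` and blocks `[N_k, N_{k+1})` with `N_k ≈ exp(m^{2k})`, so that `log N_k ≈ w_k/m` and
`log N_{k+1} ≈ m w_k`. For large `m` the terms outside the block have variance at most a small
multiple of `w_k`, and the maximal inequality makes them negligible. The block sums are independent,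
and a subgaussian tail bound from below (`le_measure_le_wsum`) gives them probabilities at least of
order `1/k`, so the second Borel–Cantelli lemma applies.

The lower limits follow from the symmetry `X ↦ -X`. -/

namespace RandomDirichlet

set_option linter.unusedSectionVars false

/-! ### Elementary estimates -/

/-- The tangent line inequality for the convex function `a ↦ a ^ (-u)`. -/
lemma rpow_neg_sub_le {u a b : ℝ} (hu : 0 < u) (ha : 0 < a) (hb : 0 < b) :
    b ^ (-u) - u * (a - b) * b ^ (-1 - u) ≤ a ^ (-u) := by
  -- After scaling by `b`: `exp y ≥ 1 + y` at `y = -u log (a/b)`, then `log x ≤ x - 1`.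
  have h1 : 1 - u * (a / b - 1) ≤ (a / b) ^ (-u) := by
    rw [Real.rpow_def_of_pos (div_pos ha hb)]
    have h2 := Real.add_one_le_exp (Real.log (a / b) * -u)
    have h3 := Real.log_le_sub_one_of_pos (div_pos ha hb)
    nlinarith
  have hbu : 0 < b ^ (-u) := Real.rpow_pos_of_pos hb _
  have h4 : b ^ (-1 - u) = b ^ (-u) / b := by
    rw [show -1 - u = -u - 1 by ring, Real.rpow_sub_one hb.ne']
  have h5 : a ^ (-u) = (a / b) ^ (-u) * b ^ (-u) := by
    rw [← Real.mul_rpow (div_pos ha hb).le hb.le, div_mul_cancel₀ _ hb.ne']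
  rw [h4, h5]
  have h6 : b ^ (-u) - u * (a - b) * (b ^ (-u) / b) = (1 - u * (a / b - 1)) * b ^ (-u) := by
    field_simp
  rw [h6]
  gcongr

lemma rpow_telescope_le {u x : ℝ} (hu : 0 < u) (hx : 0 < x) :
    x ^ (-u) - (x + 1) ^ (-u) ≤ u * x ^ (-1 - u) := by
  have := rpow_neg_sub_le hu (add_pos hx one_pos) hx
  rw [add_sub_cancel_left, mul_one] at this
  linarith

lemma le_rpow_telescope {u x : ℝ} (hu : 0 < u) (hx : 0 < x) :
    u * (x + 1) ^ (-1 - u) ≤ x ^ (-u) - (x + 1) ^ (-u) := by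
  have := rpow_neg_sub_le hu hx (add_pos hx one_pos)
  rw [sub_add_cancel_left] at this
  linarith

lemma sum_Ico_rpow_le {u : ℝ} (hu : 0 < u) {a : ℕ} (ha : 1 ≤ a) (N : ℕ) :
    ∑ n ∈ Finset.Ico a N, ((n : ℝ) + 1) ^ (-1 - u) ≤ (a : ℝ) ^ (-u) / u := by
  have ha' : (0 : ℝ) < a := by exact_mod_cast ha
  rcases le_total N a with h | h
  · rw [Finset.Ico_eq_empty_of_le h, Finset.sum_empty]
    positivity
  · have h1 : ∑ n ∈ Finset.Ico a N, u * ((n : ℝ) + 1) ^ (-1 - u) ≤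
        ∑ n ∈ Finset.Ico a N, (-((n + 1 : ℕ) : ℝ) ^ (-u) - -(n : ℝ) ^ (-u)) := by
      refine Finset.sum_le_sum fun n hn => ?_
      have hn' : (0 : ℝ) < n := by exact_mod_cast (ha.trans (Finset.mem_Ico.1 hn).1)
      have := le_rpow_telescope hu hn'
      push_cast
      linarith
    rw [Finset.sum_Ico_sub (fun n : ℕ => -(n : ℝ) ^ (-u)) h, ← Finset.mul_sum] at h1
    have h2 : 0 ≤ (N : ℝ) ^ (-u) := by positivity
    rw [le_div_iff₀ hu]
    linarith

lemma sum_range_rpow_le {u : ℝ} (hu : 0 < u) (N : ℕ) :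
    ∑ n ∈ Finset.range N, ((n : ℝ) + 1) ^ (-1 - u) ≤ 1 + 1 / u := by
  rcases Nat.eq_zero_or_pos N with rfl | h
  · simp only [Finset.range_zero, Finset.sum_empty]
    positivity
  · rw [Finset.range_eq_Ico, Finset.sum_eq_sum_Ico_succ_bot h]
    have := sum_Ico_rpow_le hu le_rfl N
    simp at this ⊢
    linarith

lemma le_sum_range_rpow {u : ℝ} (hu : 0 < u) (N : ℕ) :
    (1 - ((N : ℝ) + 1) ^ (-u)) / u ≤ ∑ n ∈ Finset.range N, ((n : ℝ) + 1) ^ (-1 - u) := by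
  have h1 : ∑ n ∈ Finset.range N, (-((n + 1 : ℕ) + 1 : ℝ) ^ (-u) - -((n : ℝ) + 1) ^ (-u)) ≤
      ∑ n ∈ Finset.range N, u * ((n : ℝ) + 1) ^ (-1 - u) := by
    refine Finset.sum_le_sum fun n _ => ?_
    have := rpow_telescope_le hu (show (0 : ℝ) < n + 1 by positivity)
    push_cast
    linarith
  rw [Finset.sum_range_sub (fun n : ℕ => -((n : ℝ) + 1) ^ (-u)), ← Finset.mul_sum] at h1
  simp at h1
  rw [div_le_iff₀ hu]
  linarith

/-- Unlike `1 + 1/u`, this bound is uniform in `u`; it controls the terms before a block, where `log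
N` is much smaller than `1/u`. -/
lemma sum_range_rpow_le_log {u : ℝ} (hu : 0 < u) (N : ℕ) :
    ∑ n ∈ Finset.range N, ((n : ℝ) + 1) ^ (-1 - u) ≤ 1 + Real.log N := by
  refine le_trans ?_ (harmonic_le_one_add_log N)
  rw [harmonic]
  push_cast
  refine Finset.sum_le_sum fun n _ => ?_
  rw [← Real.rpow_neg_one]
  exact Real.rpow_le_rpow_of_exponent_le (by simp) (by linarith)

lemma summable_rpow {u : ℝ} (hu : 0 < u) : Summable fun n : ℕ => ((n : ℝ) + 1) ^ (-1 - u) :=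
  summable_of_sum_range_le (fun _ => by positivity) (sum_range_rpow_le hu)

lemma tsum_rpow_le {u : ℝ} (hu : 0 < u) : ∑' n : ℕ, ((n : ℝ) + 1) ^ (-1 - u) ≤ 1 + 1 / u :=
  Real.tsum_le_of_sum_range_le (fun _ => by positivity) (sum_range_rpow_le hu)

lemma le_tsum_rpow {u : ℝ} (hu : 0 < u) : 1 / u ≤ ∑' n : ℕ, ((n : ℝ) + 1) ^ (-1 - u) := by
  have h1 : Tendsto (fun N : ℕ => ((N : ℝ) + 1) ^ (-u)) atTop (𝓝 0) :=
    (tendsto_rpow_neg_atTop hu).comp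
      (tendsto_atTop_add_const_right _ _ tendsto_natCast_atTop_atTop)
  have h2 := ((h1.const_sub 1).div_const u)
  rw [sub_zero] at h2
  exact le_of_tendsto_of_tendsto' h2 (summable_rpow hu).hasSum.tendsto_sum_nat
    (le_sum_range_rpow hu)

/-- Abel's inequality. -/
lemma sum_mul_le_of_antitone {b y : ℕ → ℝ} {t : ℝ} (hb : Antitone b) (hb0 : ∀ n, 0 ≤ b n)
    (hy : ∀ N, ∑ n ∈ Finset.range N, y n ≤ t) (N : ℕ) :
    ∑ n ∈ Finset.range N, b n * y n ≤ b 0 * t := by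
  -- Summation by parts in inductive form: the partial sum of `y` is kept exact at the current
  -- weight, and each decrement of `b` is charged at most `t`.
  have key : ∀ N, ∑ n ∈ Finset.range N, b n * y n ≤
      b N * ∑ n ∈ Finset.range N, y n + (b 0 - b N) * t := by
    intro N
    induction N with
    | zero => simp
    | succ N ih =>
      rw [Finset.sum_range_succ, Finset.sum_range_succ]
      have h1 := hy (N + 1)
      rw [Finset.sum_range_succ] at h1
      nlinarith [hb (Nat.le_succ N)]
  nlinarith [key N, hy N, hb0 N]

/-- Because `log f = log (f/g) + log g`, with a bounded first term and a divergent second one. -/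
lemma tendsto_log_div_log {α : Type*} {l : Filter α} {f g : α → ℝ} {c : ℝ} (hc : 0 < c)
    (hg : Tendsto g l atTop) (hfg : Tendsto (fun x => f x / g x) l (𝓝 c)) :
    Tendsto (fun x => Real.log (f x) / Real.log (g x)) l (𝓝 1) := by
  have h1 : Tendsto (fun x => Real.log (f x / g x) / Real.log (g x) + 1) l (𝓝 (0 + 1)) :=
    (((Real.continuousAt_log hc.ne').tendsto.comp hfg).div_atTop
      (Real.tendsto_log_atTop.comp hg)).add_const 1
  rw [zero_add] at h1
  refine h1.congr' ?_
  filter_upwards [hg.eventually_gt_atTop 1, hfg.eventually_const_lt hc] with x hx hx'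
  have hf : 0 < f x := by
    have := mul_pos hx' (zero_lt_one.trans hx)
    rwa [div_mul_cancel₀ _ (by linarith)] at this
  have hl := Real.log_pos hx
  rw [Real.log_div hf.ne' (by linarith)]
  field_simp
  ring

lemma tendsto_lilNorm_div_lilNorm {α : Type*} {l : Filter α} {f g : α → ℝ} {c : ℝ} (hc : 0 < c)
    (hg : Tendsto g l atTop) (hfg : Tendsto (fun x => f x / g x) l (𝓝 c)) :
    Tendsto (fun x => lilNorm (f x) / lilNorm (g x)) l (𝓝 (√c)) := by
  have h1 := tendsto_log_div_log one_pos (Real.tendsto_log_atTop.comp hg)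
    (tendsto_log_div_log hc hg hfg)
  have h2 := (hfg.mul h1).sqrt
  rw [mul_one] at h2
  refine h2.congr' ?_
  filter_upwards [hg.eventually_gt_atTop 1,
    (Real.tendsto_log_atTop.comp (Real.tendsto_log_atTop.comp hg)).eventually_gt_atTop 0]
    with x hx hx'
  simp only [lilNorm, Function.comp] at *
  rw [← Real.sqrt_div' _ (by positivity)]
  congr 1
  field_simp

lemma tendsto_loglog {α : Type*} {l : Filter α} {f : α → ℝ} (hf : Tendsto f l atTop) :
    Tendsto (fun x => Real.log (Real.log (f x))) l atTop :=
  Real.tendsto_log_atTop.comp (Real.tendsto_log_atTop.comp hf)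

lemma lilNorm_mono {x y : ℝ} (hx : Real.exp 1 ≤ x) (hxy : x ≤ y) : lilNorm x ≤ lilNorm y := by
  have h0 : 0 < x := (Real.exp_pos 1).trans_le hx
  have h1 : 1 ≤ Real.log x := (Real.le_log_iff_exp_le h0).2 hx
  have h2 : Real.log x ≤ Real.log y := Real.log_le_log h0 hxy
  have h3 : 0 ≤ Real.log (Real.log x) := Real.log_nonneg h1
  have h4 : Real.log (Real.log x) ≤ Real.log (Real.log y) := Real.log_le_log (by linarith) h2
  have h5 : 0 ≤ y := by linarith
  unfold lilNorm
  gcongr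

lemma one_add_sq_div_two_le_cosh (y : ℝ) : 1 + y ^ 2 / 2 ≤ Real.cosh y := by
  rw [← Real.cosh_abs, ← sq_abs]
  have h1 : |y| / 2 ≤ Real.sinh (|y| / 2) := Real.self_le_sinh_iff.2 (by positivity)
  have h2 : Real.cosh |y| = 1 + 2 * Real.sinh (|y| / 2) ^ 2 := by
    conv_lhs => rw [show |y| = 2 * (|y| / 2) by ring, Real.cosh_two_mul, Real.cosh_sq]
    ring
  rw [h2]
  nlinarith [abs_nonneg y]

/-- Converse to `cosh y ≤ exp (y²/2)` for small `y`; it makes the exponential moment of a sum with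
small coefficients nearly Gaussian from below. -/
lemma exp_le_cosh {η y : ℝ} (hη : 0 < η) (hy : y ^ 2 ≤ 2 * η) :
    Real.exp ((1 - η) * y ^ 2 / 2) ≤ Real.cosh y := by
  have h1 : 1 + y ^ 2 / 2 ≤ Real.cosh y := one_add_sq_div_two_le_cosh y
  refine le_trans ?_ h1
  rw [← Real.le_log_iff_exp_le (by positivity)]
  have h2 := Real.one_sub_inv_le_log_of_pos (x := 1 + y ^ 2 / 2) (by positivity)
  refine le_trans ?_ h2
  have : 1 - (1 + y ^ 2 / 2)⁻¹ = (y ^ 2 / 2) / (1 + y ^ 2 / 2) := by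
    field_simp
    ring
  rw [this, le_div_iff₀ (by positivity)]
  nlinarith [sq_nonneg y, mul_nonneg (sq_nonneg y) (sq_nonneg y)]

/-! ### Weighted sums of Rademacher signs -/

/-- The weighted partial sum `∑_{n<N} a n * X n`. -/
def wsum {Ω : Type*} (X : ℕ → Ω → ℝ) (a : ℕ → ℝ) (N : ℕ) (ω : Ω) : ℝ :=
  ∑ n ∈ Finset.range N, a n * X n ω

section
variable {Ω : Type*} [MeasurableSpace Ω] {P : Measure Ω} [IsProbabilityMeasure P]
  {X : ℕ → Ω → ℝ}

namespace IsRademacher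

lemma neg (hX : IsRademacher P X) : IsRademacher P (fun n ω => -X n ω) where
  measurable n := (hX.measurable n).neg
  indep := hX.indep.comp (fun _ x => -x) fun _ => measurable_neg
  prob_one n := by simpa [neg_eq_iff_eq_neg] using hX.prob_neg_one n
  prob_neg_one n := by simpa using hX.prob_one n

lemma ae_eq_one_or (hX : IsRademacher P X) : ∀ᵐ ω ∂P, ∀ n, X n ω = 1 ∨ X n ω = -1 := by
  rw [ae_all_iff]
  intro n
  have hm : ∀ c, MeasurableSet {ω | X n ω = c} := fun c =>
    (hX.measurable n) (measurableSet_singleton c)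
  have hd : Disjoint {ω | X n ω = 1} {ω | X n ω = -1} := by
    rw [Set.disjoint_left]
    intro ω h1 h2
    simp only [Set.mem_ofPred_eq] at h1 h2
    linarith
  have h : P ({ω | X n ω = 1} ∪ {ω | X n ω = -1}) = 1 := by
    rw [measure_union hd (hm _), hX.prob_one, hX.prob_neg_one, ENNReal.add_halves]
  have h2 := (prob_compl_eq_zero_iff ((hm 1).union (hm (-1)))).2 h
  rw [ae_iff]
  convert h2 using 2
  ext ω
  simp

lemma ae_abs (hX : IsRademacher P X) : ∀ᵐ ω ∂P, ∀ n, |X n ω| = 1 := by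
  filter_upwards [hX.ae_eq_one_or] with ω h n
  rcases h n with h | h <;> simp [h]

lemma integral_comp (hX : IsRademacher P X) (g : ℝ → ℝ) (n : ℕ) :
    ∫ ω, g (X n ω) ∂P = (g 1 + g (-1)) / 2 := by
  have hm : ∀ c, MeasurableSet {ω | X n ω = c} := fun c =>
    (hX.measurable n) (measurableSet_singleton c)
  have h1 : (fun ω => g (X n ω)) =ᵐ[P] fun ω => {ω | X n ω = 1}.indicator (fun _ => g 1) ω +
      {ω | X n ω = -1}.indicator (fun _ => g (-1)) ω := by
    filter_upwards [hX.ae_eq_one_or] with ω h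
    rcases h n with h | h
    · have : ω ∉ {ω | X n ω = -1} := by simp [h]; norm_num
      rw [Set.indicator_of_mem (by exact h), Set.indicator_of_notMem this, h, add_zero]
    · have : ω ∉ {ω | X n ω = 1} := by simp [h]; norm_num
      rw [Set.indicator_of_notMem this, Set.indicator_of_mem (by exact h), h, zero_add]
  rw [integral_congr_ae h1, integral_add ((integrable_const _).indicator (hm _))
    ((integrable_const _).indicator (hm _)), integral_indicator_const _ (hm _),
    integral_indicator_const _ (hm _), measureReal_def, measureReal_def, hX.prob_one,
    hX.prob_neg_one]
  simp
  ring

lemma measurable_wsum (hX : IsRademacher P X) (a : ℕ → ℝ) (N : ℕ) : Measurable (wsum X a N) :=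
  Finset.measurable_sum _ fun n _ => (hX.measurable n).const_mul _

lemma ae_abs_wsum_le (hX : IsRademacher P X) (a : ℕ → ℝ) (N : ℕ) :
    ∀ᵐ ω ∂P, |wsum X a N ω| ≤ ∑ n ∈ Finset.range N, |a n| := by
  filter_upwards [hX.ae_abs] with ω h
  refine (Finset.abs_sum_le_sum_abs _ _).trans (Finset.sum_le_sum fun n _ => ?_)
  rw [abs_mul, h n, mul_one]

lemma memLp_wsum (hX : IsRademacher P X) (a : ℕ → ℝ) (N : ℕ) : MemLp (wsum X a N) 2 P :=
  MemLp.of_bound (hX.measurable_wsum a N).aestronglyMeasurable _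
    (by simpa using hX.ae_abs_wsum_le a N)

lemma integrable_exp_wsum (hX : IsRademacher P X) (a : ℕ → ℝ) (N : ℕ) :
    Integrable (fun ω => Real.exp (wsum X a N ω)) P := by
  refine Integrable.of_bound (hX.measurable_wsum a N).exp.aestronglyMeasurable
    (Real.exp (∑ n ∈ Finset.range N, |a n|)) ?_
  filter_upwards [hX.ae_abs_wsum_le a N] with ω h
  rw [Real.norm_eq_abs, Real.abs_exp]
  exact Real.exp_le_exp.2 ((le_abs_self _).trans h)

lemma integral_exp_mul (hX : IsRademacher P X) (c : ℝ) (n : ℕ) :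
    ∫ ω, Real.exp (c * X n ω) ∂P = Real.cosh c := by
  rw [hX.integral_comp (fun x => Real.exp (c * x)), Real.cosh_eq]
  simp

lemma integral_exp_wsum (hX : IsRademacher P X) (a : ℕ → ℝ) (N : ℕ) :
    ∫ ω, Real.exp (wsum X a N ω) ∂P = ∏ n ∈ Finset.range N, Real.cosh (a n) := by
  have h := (hX.indep.comp (fun n x => Real.exp (a n * x)) fun n => by fun_prop)
  have h' := (h.precomp (g := ((↑) : Finset.range N → ℕ)) Subtype.val_injective
    ).integral_fun_prod_eq_prod_integral fun n => by
      have := hX.measurable n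
      simp only [Function.comp_def]
      fun_prop
  simp only [Function.comp_def, hX.integral_exp_mul] at h'
  rw [Finset.prod_coe_sort (Finset.range N) fun n => Real.cosh (a n)] at h'
  rw [← h']
  congr 1
  ext ω
  rw [Finset.prod_coe_sort (Finset.range N) fun n => Real.exp (a n * X n ω), wsum, Real.exp_sum]

lemma integral_exp_wsum_le (hX : IsRademacher P X) (a : ℕ → ℝ) (N : ℕ) :
    ∫ ω, Real.exp (wsum X a N ω) ∂P ≤ Real.exp ((∑ n ∈ Finset.range N, a n ^ 2) / 2) := by
  rw [hX.integral_exp_wsum, Finset.sum_div, Real.exp_sum]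
  exact Finset.prod_le_prod (fun _ _ => (Real.cosh_pos _).le) fun _ _ => Real.cosh_le_exp_half_sq _

lemma le_integral_exp_wsum (hX : IsRademacher P X) {η : ℝ} (hη : 0 < η) (a : ℕ → ℝ) (N : ℕ)
    (ha : ∀ n < N, a n ^ 2 ≤ 2 * η) :
    Real.exp ((1 - η) * (∑ n ∈ Finset.range N, a n ^ 2) / 2) ≤
      ∫ ω, Real.exp (wsum X a N ω) ∂P := by
  rw [hX.integral_exp_wsum, Finset.mul_sum, Finset.sum_div, Real.exp_sum]
  exact Finset.prod_le_prod (fun _ _ => (Real.exp_pos _).le) fun n hn =>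
    exp_le_cosh hη (ha n (Finset.mem_range.1 hn))

/-! ### Martingale properties -/

/-- The filtration generated by the signs. -/
noncomputable def filtration (hX : IsRademacher P X) : Filtration ℕ ‹MeasurableSpace Ω› :=
  Filtration.natural X fun n => (hX.measurable n).stronglyMeasurable

/-- The sum of the first `n + 1` terms involves `X 0, …, X n`, hence the shift by one between sums
and filtration. -/
lemma stronglyMeasurable_wsum (hX : IsRademacher P X) (a : ℕ → ℝ) {n N : ℕ} (h : N ≤ n + 1) :
    StronglyMeasurable[hX.filtration n] (wsum X a N) := by
  refine (Finset.measurable_sum _ fun k hk => ?_).stronglyMeasurable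
  have h1 : Measurable[hX.filtration k] (X k) :=
    ((Filtration.stronglyAdapted_natural
      fun n => (hX.measurable n).stronglyMeasurable) k).measurable
  exact (h1.mono (hX.filtration.mono (by have := Finset.mem_range.1 hk; omega)) le_rfl).const_mul _

lemma condExp_comp_succ (hX : IsRademacher P X) {g : ℝ → ℝ} (hg : Measurable g) (n : ℕ) :
    P[fun ω => g (X (n + 1) ω) | hX.filtration n] =ᵐ[P] fun _ => (g 1 + g (-1)) / 2 := by
  rw [← hX.integral_comp g (n + 1)]
  exact condExp_indep_eq (hX.measurable (n + 1)).comap_le (hX.filtration.le n)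
    (hg.comp (comap_measurable (X (n + 1)))).stronglyMeasurable
    (hX.indep.indep_comap_natural_of_lt _ n.lt_succ_self)

lemma integrable_comp (hX : IsRademacher P X) {g : ℝ → ℝ} (hg : Measurable g) (n : ℕ) :
    Integrable (fun ω => g (X n ω)) P := by
  refine Integrable.of_bound (hg.comp (hX.measurable n)).aestronglyMeasurable
    (|g 1| + |g (-1)|) ?_
  filter_upwards [hX.ae_eq_one_or] with ω h
  rcases h n with h | h <;> simp [h]

lemma submartingale_exp_wsum (hX : IsRademacher P X) (a : ℕ → ℝ) :
    Submartingale (fun n ω => Real.exp (wsum X a (n + 1) ω)) hX.filtration P := by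
  refine submartingale_nat (fun n => ?_) (fun n => hX.integrable_exp_wsum a _) fun n => ?_
  · exact Real.continuous_exp.comp_stronglyMeasurable (hX.stronglyMeasurable_wsum a le_rfl)
  · have hg : Measurable fun x => Real.exp (a (n + 1) * x) := by fun_prop
    have h1 : (fun ω => Real.exp (wsum X a (n + 1 + 1) ω)) =
        (fun ω => Real.exp (wsum X a (n + 1) ω)) * fun ω => Real.exp (a (n + 1) * X (n + 1) ω) := by
      ext ω
      simp [wsum, Finset.sum_range_succ _ (n + 1), Real.exp_add]
    have h2 := condExp_mul_of_stronglyMeasurable_left (μ := P) (m := hX.filtration n)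
      (f := fun ω => Real.exp (wsum X a (n + 1) ω))
      (g := fun ω => Real.exp (a (n + 1) * X (n + 1) ω))
      (Real.continuous_exp.comp_stronglyMeasurable (hX.stronglyMeasurable_wsum a le_rfl))
      (h1 ▸ hX.integrable_exp_wsum a _) (hX.integrable_comp hg (n + 1))
    rw [h1]
    filter_upwards [h2, hX.condExp_comp_succ hg n] with ω h3 h4
    rw [h3, Pi.mul_apply, h4]
    have := Real.one_le_cosh (a (n + 1))
    rw [Real.cosh_eq] at this
    simp only [mul_one, mul_neg]
    exact le_mul_of_one_le_right (Real.exp_pos _).le this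

lemma martingale_wsum (hX : IsRademacher P X) (a : ℕ → ℝ) :
    Martingale (fun n ω => wsum X a (n + 1) ω) hX.filtration P := by
  refine martingale_nat (fun n => hX.stronglyMeasurable_wsum a le_rfl)
    (fun n => (hX.memLp_wsum a _).integrable one_le_two) fun n => ?_
  have hg : Measurable fun x => a (n + 1) * x := by fun_prop
  have h1 : (fun ω => wsum X a (n + 1 + 1) ω) =
      (fun ω => wsum X a (n + 1) ω) + fun ω => a (n + 1) * X (n + 1) ω := by
    ext ω
    simp [wsum, Finset.sum_range_succ _ (n + 1)]
  have hi : Integrable (fun ω => wsum X a (n + 1) ω) P :=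
    (hX.memLp_wsum a _).integrable one_le_two
  rw [h1]
  filter_upwards [condExp_add hi (hX.integrable_comp hg (n + 1)) (hX.filtration n),
    hX.condExp_comp_succ hg n] with ω h3 h4
  rw [h3, Pi.add_apply, h4, condExp_of_stronglyMeasurable (hX.filtration.le n)
    (hX.stronglyMeasurable_wsum a le_rfl) hi]
  simp

/-- The subgaussian maximal inequality. -/
lemma measure_exists_le_wsum (hX : IsRademacher P X) (a : ℕ → ℝ) {v t : ℝ} (hv : 0 < v)
    (ht : 0 < t) (ha : ∀ N, ∑ n ∈ Finset.range N, a n ^ 2 ≤ v) :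
    P {ω | ∃ N, t ≤ wsum X a N ω} ≤ ENNReal.ofReal (Real.exp (-t ^ 2 / (2 * v))) := by
  -- The minimiser of `λ² v / 2 - λ t`, with minimum `-t² / (2v)`.
  set lam := t / v with hlam
  have hl : 0 < lam := div_pos ht hv
  have hw : ∀ N ω, wsum X (fun n => lam * a n) N ω = lam * wsum X a N ω := by
    intro N ω
    simp [wsum, Finset.mul_sum, mul_assoc]
  have hfin : ∀ n : ℕ, P {ω | ∃ N ≤ n, t ≤ wsum X a (N + 1) ω} ≤
      ENNReal.ofReal (Real.exp (-t ^ 2 / (2 * v))) := by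
    intro n
    have h := maximal_ineq (hX.submartingale_exp_wsum fun n => lam * a n)
      (fun n ω => (Real.exp_pos _).le) (ε := (Real.exp (lam * t)).toNNReal) n
    rw [Real.coe_toNNReal _ (Real.exp_pos _).le] at h
    set A := {ω | Real.exp (lam * t) ≤
      (Finset.range (n + 1)).sup' Finset.nonempty_range_add_one
        fun k => Real.exp (wsum X (fun n => lam * a n) (k + 1) ω)} with hA
    have hsub : {ω | ∃ N ≤ n, t ≤ wsum X a (N + 1) ω} ⊆ A := by
      rintro ω ⟨N, hN, h⟩
      simp only [hA, Set.mem_ofPred_eq, Finset.le_sup'_iff]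
      refine ⟨N, Finset.mem_range.2 (by omega), ?_⟩
      rw [hw]
      gcongr
    have hint : ∫ ω in A, Real.exp (wsum X (fun n => lam * a n) (n + 1) ω) ∂P ≤
        Real.exp (lam ^ 2 * v / 2) := by
      refine (setIntegral_le_integral (hX.integrable_exp_wsum _ _)
        (ae_of_all _ fun ω => (Real.exp_pos _).le)).trans ?_
      refine (hX.integral_exp_wsum_le _ _).trans (Real.exp_le_exp.2 ?_)
      simp only [mul_pow, ← Finset.mul_sum]
      have := ha (n + 1)
      gcongr
    have h2 := h.trans (ENNReal.ofReal_le_ofReal hint)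
    change ENNReal.ofReal (Real.exp (lam * t)) * P A ≤ _ at h2
    have h4 : Real.exp (-t ^ 2 / (2 * v)) =
        (Real.exp (lam * t))⁻¹ * Real.exp (lam ^ 2 * v / 2) := by
      rw [← Real.exp_neg, ← Real.exp_add]
      congr 1
      rw [hlam]
      field_simp
      ring
    refine (measure_mono hsub).trans ?_
    rw [h4, ENNReal.ofReal_mul (by positivity), ENNReal.ofReal_inv_of_pos (Real.exp_pos _),
      ← ENNReal.div_eq_inv_mul]
    rw [ENNReal.le_div_iff_mul_le (Or.inl (by simpa using Real.exp_pos _))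
      (Or.inl ENNReal.ofReal_ne_top), mul_comm]
    exact h2
  have hU : {ω | ∃ N, t ≤ wsum X a N ω} = ⋃ n : ℕ, {ω | ∃ N ≤ n, t ≤ wsum X a (N + 1) ω} := by
    ext ω
    simp only [Set.mem_ofPred_eq, Set.mem_iUnion]
    constructor
    · rintro ⟨N, h⟩
      cases N with
      -- The empty sum cannot reach `t > 0`, so only sums of length at least one remain.
      | zero => simp [wsum] at h; linarith
      | succ N => exact ⟨N, N, le_rfl, h⟩
    · rintro ⟨_, N, _, h⟩
      exact ⟨_, h⟩
  rw [hU]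
  refine le_of_tendsto' (tendsto_measure_iUnion_atTop ?_) hfin
  intro m n hmn ω
  rintro ⟨N, hN, h⟩
  exact ⟨N, hN.trans hmn, h⟩

/-! ### Second moments and convergence -/

lemma integral_wsum (hX : IsRademacher P X) (a : ℕ → ℝ) (N : ℕ) : ∫ ω, wsum X a N ω ∂P = 0 := by
  simp only [wsum]
  rw [integral_finsetSum _ fun n _ =>
    hX.integrable_comp (by fun_prop : Measurable fun x => a n * x) n]
  refine Finset.sum_eq_zero fun n _ => ?_
  rw [hX.integral_comp (fun x => a n * x)]
  simp

lemma integral_wsum_sq (hX : IsRademacher P X) (a : ℕ → ℝ) (N : ℕ) :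
    ∫ ω, wsum X a N ω ^ 2 ∂P = ∑ n ∈ Finset.range N, a n ^ 2 := by
  have hind := hX.indep.comp (fun n x => a n * x) fun n => by fun_prop
  have hmem : ∀ n, MemLp (fun ω => a n * X n ω) 2 P := fun n => by
    refine MemLp.of_bound ((hX.measurable n).const_mul _).aestronglyMeasurable |a n| ?_
    filter_upwards [hX.ae_abs] with ω h
    rw [Real.norm_eq_abs, abs_mul, h n, mul_one]
  have h := IndepFun.variance_sum (s := Finset.range N) (fun n _ => hmem n)
    fun i _ j _ hij => hind.indepFun hij
  have h1 : (∑ n ∈ Finset.range N, fun ω => a n * X n ω) = wsum X a N := by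
    ext ω
    simp [wsum]
  rw [h1, variance_of_integral_eq_zero (hX.measurable_wsum a N).aemeasurable
    (hX.integral_wsum a N)] at h
  rw [h]
  refine Finset.sum_congr rfl fun n _ => ?_
  rw [variance_of_integral_eq_zero ((hX.measurable n).const_mul _).aemeasurable]
  · rw [hX.integral_comp (fun x => (a n * x) ^ 2)]
    ring
  · rw [hX.integral_comp (fun x => a n * x)]
    simp

end IsRademacher

lemma eLpNorm_two_eq {f : Ω → ℝ} (hf : MemLp f 2 P) :
    eLpNorm f 2 P = ENNReal.ofReal √(∫ ω, f ω ^ 2 ∂P) := by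
  rw [hf.eLpNorm_eq_integral_rpow_norm (by norm_num) (by norm_num)]
  simp [Real.sqrt_eq_rpow]

namespace IsRademacher

lemma eLpNorm_wsum (hX : IsRademacher P X) (a : ℕ → ℝ) (N : ℕ) :
    eLpNorm (wsum X a N) 2 P = ENNReal.ofReal √(∑ n ∈ Finset.range N, a n ^ 2) := by
  rw [eLpNorm_two_eq (hX.memLp_wsum a N), hX.integral_wsum_sq]

lemma ae_exists_tendsto_wsum (hX : IsRademacher P X) {a : ℕ → ℝ} (ha : Summable fun n => a n ^ 2) :
    ∀ᵐ ω ∂P, ∃ c, Tendsto (fun N => wsum X a N ω) atTop (𝓝 c) := by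
  have h := (hX.martingale_wsum a).submartingale.exists_ae_tendsto_of_bdd
    (R := (√(∑' n, a n ^ 2)).toNNReal) fun n => by
      refine (eLpNorm_le_eLpNorm_of_exponent_le one_le_two
        (hX.measurable_wsum a _).aestronglyMeasurable).trans ?_
      rw [hX.eLpNorm_wsum]
      refine ENNReal.ofReal_le_ofReal (Real.sqrt_le_sqrt ?_)
      exact ha.sum_le_tsum _ fun _ _ => sq_nonneg _
  filter_upwards [h] with ω hω
  exact hω.imp fun c hc => (tendsto_add_atTop_iff_nat 1).1 hc

lemma wsum_sub_wsum (a : ℕ → ℝ) {M N : ℕ} (h : N ≤ M) (ω : Ω) :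
    wsum X a M ω - wsum X a N ω = wsum X (fun n => if n < N then 0 else a n) M ω := by
  obtain ⟨k, rfl⟩ := Nat.exists_eq_add_of_le h
  have h1 : wsum X (fun n => if n < N then 0 else a n) N ω = 0 :=
    Finset.sum_eq_zero fun n hn => by simp [Finset.mem_range.1 hn]
  simp only [wsum] at *
  rw [Finset.sum_range_add, Finset.sum_range_add, h1]
  simp

lemma memLp_and_integral_sq_of_tendsto (hX : IsRademacher P X) {a : ℕ → ℝ}
    (ha : Summable fun n => a n ^ 2) {G : Ω → ℝ}
    (hG : ∀ᵐ ω ∂P, Tendsto (fun N => wsum X a N ω) atTop (𝓝 (G ω))) :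
    MemLp G 2 P ∧ ∫ ω, G ω ^ 2 ∂P = ∑' n, a n ^ 2 := by
  have hGm : AEStronglyMeasurable G P :=
    aestronglyMeasurable_of_tendsto_ae atTop
      (fun N => (hX.measurable_wsum a N).aestronglyMeasurable) hG
  set r : ℕ → ℝ := fun N => (∑' n, a n ^ 2) - ∑ n ∈ Finset.range N, a n ^ 2 with hr
  have hr0 : Tendsto (fun N => ENNReal.ofReal √(r N)) atTop (𝓝 0) := by
    have h1 : Tendsto r atTop (𝓝 0) := by
      have h2 := ha.hasSum.tendsto_sum_nat.const_sub (∑' n, a n ^ 2)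
      rwa [sub_self] at h2
    simpa using ENNReal.tendsto_ofReal h1.sqrt
  -- Lower semicontinuity of the L² norm under almost sure limits: differences of partial sums have
  -- norm at most the tail `√(r N)`.
  have hdiff : ∀ N, eLpNorm (fun ω => G ω - wsum X a N ω) 2 P ≤ ENNReal.ofReal √(r N) := by
    intro N
    refine Lp.eLpNorm_le_of_ae_tendsto (u := atTop) (f := fun M ω => wsum X a M ω - wsum X a N ω)
      ?_ (fun M => ((hX.measurable_wsum a M).sub (hX.measurable_wsum a N)).aestronglyMeasurable) ?_
    · filter_upwards [eventually_ge_atTop N] with M hM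
      have : (fun ω => wsum X a M ω - wsum X a N ω) =
          wsum X (fun n => if n < N then 0 else a n) M := funext fun ω => wsum_sub_wsum a hM ω
      rw [this, hX.eLpNorm_wsum]
      refine ENNReal.ofReal_le_ofReal (Real.sqrt_le_sqrt ?_)
      have h2 : ∑ n ∈ Finset.range M, (if n < N then 0 else a n) ^ 2 =
          ∑ n ∈ Finset.range M, a n ^ 2 - ∑ n ∈ Finset.range N, a n ^ 2 := by
        rw [← Finset.sum_sdiff (Finset.range_subset_range.2 hM),
          ← Finset.sum_sdiff (f := fun n => a n ^ 2) (Finset.range_subset_range.2 hM),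
          add_sub_cancel_right]
        rw [Finset.sum_eq_zero (s := Finset.range N) fun n hn => by simp [Finset.mem_range.1 hn],
          add_zero]
        refine Finset.sum_congr rfl fun n hn => ?_
        simp only [Finset.mem_sdiff, Finset.mem_range] at hn
        simp [hn.2]
      rw [h2]
      have := ha.sum_le_tsum (Finset.range M) fun _ _ => sq_nonneg _
      simp only [hr]
      linarith
    · filter_upwards [hG] with ω h
      exact h.sub_const _
  have hmem : MemLp G 2 P := by
    have h1 : MemLp (fun ω => G ω - wsum X a 0 ω) 2 P :=
      ⟨hGm.sub (hX.measurable_wsum a 0).aestronglyMeasurable,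
        (hdiff 0).trans_lt ENNReal.ofReal_lt_top⟩
    simpa [wsum] using h1
  refine ⟨hmem, ?_⟩
  have hlim : Tendsto (fun N => eLpNorm (wsum X a N) 2 P) atTop
      (𝓝 (ENNReal.ofReal √(∑' n, a n ^ 2))) := by
    simp only [hX.eLpNorm_wsum]
    exact ENNReal.tendsto_ofReal ha.hasSum.tendsto_sum_nat.sqrt
  have hle : eLpNorm G 2 P ≤ ENNReal.ofReal √(∑' n, a n ^ 2) := by
    have h1 := hlim.add hr0
    rw [add_zero] at h1
    refine ge_of_tendsto' h1 fun N => ?_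
    refine le_trans ?_ (add_le_add_right (hdiff N) _)
    refine le_trans (le_of_eq ?_) (eLpNorm_add_le (hX.measurable_wsum a N).aestronglyMeasurable
      (hGm.sub (hX.measurable_wsum a N).aestronglyMeasurable) one_le_two)
    congr 1
    ext ω
    simp
  have hge : ENNReal.ofReal √(∑' n, a n ^ 2) ≤ eLpNorm G 2 P := by
    have h1 := (tendsto_const_nhds (x := eLpNorm G 2 P)).add hr0
    rw [add_zero] at h1
    refine le_of_tendsto_of_tendsto' hlim h1 fun N => ?_
    refine le_trans ?_ (add_le_add_right (hdiff N) _)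
    refine le_trans (le_of_eq ?_) (eLpNorm_sub_le hGm
      (hGm.sub (hX.measurable_wsum a N).aestronglyMeasurable) one_le_two)
    congr 1
    ext ω
    simp
  have heq := le_antisymm hle hge
  rw [eLpNorm_two_eq hmem, ENNReal.ofReal_eq_ofReal_iff (Real.sqrt_nonneg _) (Real.sqrt_nonneg _),
    Real.sqrt_inj (integral_nonneg fun _ => sq_nonneg _) (tsum_nonneg fun _ => sq_nonneg _)] at heq
  exact heq

end IsRademacher
end

/-! ### Tail bound from below and independence of blocks. -/

section
variable {Ω : Type*} [MeasurableSpace Ω] {P : Measure Ω} [IsProbabilityMeasure P]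
  {X : ℕ → Ω → ℝ}

namespace IsRademacher

/-- A lower bound for the tail of a Rademacher sum with small coefficients, matching the
subgaussian upper bound up to a factor `1 + O(δ)` in the exponent. -/
lemma le_measure_le_wsum (hX : IsRademacher P X) {δ : ℝ} (hδ : 0 < δ) (hδ1 : δ < 1) (a : ℕ → ℝ)
    (N : ℕ) (ha : ∀ n < N, a n ^ 2 ≤ δ ^ 2) {V : ℝ} (hV : ∑ n ∈ Finset.range N, a n ^ 2 = V)
    (hV4 : 4 ≤ Real.exp (δ ^ 2 * V / 4)) :
    ENNReal.ofReal (1 / 2 * Real.exp (-(1 + 3 * δ) * V / 2)) ≤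
      P {ω | (1 - δ) * V ≤ wsum X a N ω} := by
  set T := wsum X a N with hT
  set A := {ω | (1 - δ) * V ≤ T ω} with hA
  have hAm : MeasurableSet A := measurableSet_le measurable_const (hX.measurable_wsum a N)
  have hw : ∀ c ω, wsum X (fun n => c * a n) N ω = c * T ω := by
    intro c ω
    simp [hT, wsum, Finset.mul_sum, mul_assoc]
  have hint : ∀ c, Integrable (fun ω => Real.exp (c * T ω)) P := by
    intro c
    simpa only [hw] using hX.integrable_exp_wsum (fun n => c * a n) N
  have hup : ∀ c, ∫ ω, Real.exp (c * T ω) ∂P ≤ Real.exp (c ^ 2 * V / 2) := by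
    intro c
    have := hX.integral_exp_wsum_le (fun n => c * a n) N
    simpa only [hw, mul_pow, ← Finset.mul_sum, hV] using this
  have hlow : Real.exp ((1 - δ ^ 2 / 2) * V / 2) ≤ ∫ ω, Real.exp (T ω) ∂P := by
    have := hX.le_integral_exp_wsum (η := δ ^ 2 / 2) (by positivity) a N
      (fun n hn => (ha n hn).trans (by linarith))
    rwa [hV] at this
  have hV0 : 0 ≤ V := hV ▸ Finset.sum_nonneg fun _ _ => sq_nonneg _
  -- Splits `exp T` at `(1 ± δ) V`. On either outer range a change of exponent to `1 ± δ` gains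
  -- enough that its mean is at most `exp ((1 - δ²) V / 2)`, below the total mean; hence the middle
  -- range must carry substantial mass.
  have hpt : ∀ ω, Real.exp (T ω) ≤ Real.exp (-(δ * (1 + δ) * V)) * Real.exp ((1 + δ) * T ω) +
      Real.exp (δ * (1 - δ) * V) * Real.exp ((1 - δ) * T ω) +
      A.indicator (fun _ => Real.exp ((1 + δ) * V)) ω := by
    intro ω
    have h1 : 0 ≤ Real.exp (-(δ * (1 + δ) * V)) * Real.exp ((1 + δ) * T ω) := by positivity
    have h2 : 0 ≤ Real.exp (δ * (1 - δ) * V) * Real.exp ((1 - δ) * T ω) := by positivity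
    have h3 : 0 ≤ A.indicator (fun _ => Real.exp ((1 + δ) * V)) ω :=
      Set.indicator_nonneg (fun _ _ => (Real.exp_pos _).le) ω
    rcases le_total ((1 + δ) * V) (T ω) with h | h
    · have : Real.exp (T ω) ≤ Real.exp (-(δ * (1 + δ) * V)) * Real.exp ((1 + δ) * T ω) := by
        rw [← Real.exp_add]
        exact Real.exp_le_exp.2 (by nlinarith)
      linarith
    · by_cases h' : (1 - δ) * V ≤ T ω
      · have : A.indicator (fun _ => Real.exp ((1 + δ) * V)) ω = Real.exp ((1 + δ) * V) :=
          Set.indicator_of_mem (by exact h') _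
        rw [this]
        have := Real.exp_le_exp.2 h
        linarith
      · have : Real.exp (T ω) ≤ Real.exp (δ * (1 - δ) * V) * Real.exp ((1 - δ) * T ω) := by
          rw [← Real.exp_add]
          exact Real.exp_le_exp.2 (by nlinarith)
        linarith
  have hI1 := (hint (1 + δ)).const_mul (Real.exp (-(δ * (1 + δ) * V)))
  have hI2 := (hint (1 - δ)).const_mul (Real.exp (δ * (1 - δ) * V))
  have hI3 : Integrable (A.indicator fun _ => Real.exp ((1 + δ) * V)) P :=
    (integrable_const _).indicator hAm
  have h1 := integral_mono (by simpa using hint 1) ((hI1.add hI2).add hI3) hpt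
  rw [integral_add' (hI1.add hI2) hI3, integral_add' hI1 hI2, integral_const_mul,
    integral_const_mul,
    integral_indicator_const _ hAm, smul_eq_mul] at h1
  have h2 : Real.exp (-(δ * (1 + δ) * V)) * ∫ ω, Real.exp ((1 + δ) * T ω) ∂P ≤
      Real.exp ((1 - δ ^ 2) * V / 2) := by
    refine (mul_le_mul_of_nonneg_left (hup _) (Real.exp_pos _).le).trans ?_
    rw [← Real.exp_add]
    exact Real.exp_le_exp.2 (by nlinarith)
  have h3 : Real.exp (δ * (1 - δ) * V) * ∫ ω, Real.exp ((1 - δ) * T ω) ∂P ≤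
      Real.exp ((1 - δ ^ 2) * V / 2) := by
    refine (mul_le_mul_of_nonneg_left (hup _) (Real.exp_pos _).le).trans ?_
    rw [← Real.exp_add]
    exact Real.exp_le_exp.2 (by nlinarith)
  have h4 : Real.exp ((1 - δ ^ 2 / 2) * V / 2) =
      Real.exp (δ ^ 2 * V / 4) * Real.exp ((1 - δ ^ 2) * V / 2) := by
    rw [← Real.exp_add]
    congr 1
    ring
  -- By `hV4` the total mean is at least four times each outer bound, so the two outer ranges take
  -- at most half of it.
  have h5 : 1 / 2 * Real.exp ((1 - δ ^ 2 / 2) * V / 2) ≤ P.real A * Real.exp ((1 + δ) * V) := by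
    have := mul_le_mul_of_nonneg_right hV4 (Real.exp_pos ((1 - δ ^ 2) * V / 2)).le
    rw [← h4] at this
    linarith
  have h6 : 1 / 2 * Real.exp (-(1 + 3 * δ) * V / 2) ≤ P.real A := by
    have h7 : Real.exp ((1 - δ ^ 2 / 2) * V / 2) =
        Real.exp (-(1 + 2 * δ + δ ^ 2 / 2) * V / 2) * Real.exp ((1 + δ) * V) := by
      rw [← Real.exp_add]
      congr 1
      ring
    rw [h7, ← mul_assoc] at h5
    refine le_trans ?_ (le_of_mul_le_mul_right h5 (Real.exp_pos _))
    have : Real.exp (-(1 + 3 * δ) * V / 2) ≤ Real.exp (-(1 + 2 * δ + δ ^ 2 / 2) * V / 2) :=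
      Real.exp_le_exp.2 (by nlinarith [mul_nonneg hδ.le hV0])
    linarith
  rw [← ofReal_measureReal (μ := P)]
  exact ENNReal.ofReal_le_ofReal h6

/-- Events determined by disjoint blocks of signs are independent. -/
lemma iIndepSet_of_blocks (hX : IsRademacher P X) {B : ℕ → Set ℕ}
    (hB : Pairwise (Function.onFun Disjoint B))
    {A : ℕ → Set Ω}
    (hA : ∀ k, MeasurableSet[⨆ n ∈ B k, MeasurableSpace.comap (X n) inferInstance] (A k)) :
    iIndepSet A P := by
  have hle : ∀ n, MeasurableSpace.comap (X n) inferInstance ≤ ‹MeasurableSpace Ω› :=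
    fun n => (hX.measurable n).comap_le
  have hAm : ∀ k, MeasurableSet (A k) := fun k => (iSup₂_le fun n _ => hle n) _ (hA k)
  rw [iIndepSet_iff_meas_biInter hAm]
  intro s
  induction s using Finset.induction_on with
  | empty => simp
  | insert i s hi ih =>
    rw [Finset.prod_insert hi, ← ih, Finset.set_biInter_insert]
    have hd : Disjoint (B i) (⋃ k ∈ s, B k) := by
      simp only [Set.disjoint_iUnion_right]
      intro k hk
      exact hB fun h => hi (h ▸ hk)
    have h := indep_iSup_of_disjoint hle hX.indep.iIndep hd
    refine (Indep_iff _ _ _).1 h _ _ (hA i) ?_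
    refine Finset.measurableSet_biInter _ fun k hk => ?_
    have hmono : (⨆ n ∈ B k, MeasurableSpace.comap (X n) inferInstance) ≤
        ⨆ n ∈ ⋃ k ∈ s, B k, MeasurableSpace.comap (X n) inferInstance :=
      biSup_mono fun n hn => Set.mem_biUnion hk hn
    exact hmono _ (hA k)

end IsRademacher
end

/-! ### The random Dirichlet series -/

/-- The coefficient `m ^ (-σ)` with `m = n + 1`. -/
noncomputable def coef (σ : ℝ) (n : ℕ) : ℝ := ((n : ℝ) + 1) ^ (-σ)

lemma coef_nonneg (σ : ℝ) (n : ℕ) : 0 ≤ coef σ n := by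
  unfold coef
  positivity

lemma coef_sq (σ : ℝ) (n : ℕ) : coef σ n ^ 2 = ((n : ℝ) + 1) ^ (-1 - (2 * σ - 1)) := by
  rw [coef, ← Real.rpow_natCast, ← Real.rpow_mul (by positivity)]
  congr 1
  push_cast
  ring

lemma coef_sq_le_one {σ : ℝ} (hσ : 1 / 2 < σ) (n : ℕ) : coef σ n ^ 2 ≤ 1 := by
  rw [coef_sq]
  exact Real.rpow_le_one_of_one_le_of_nonpos (by simp) (by linarith)

lemma summable_coef_sq {σ : ℝ} (hσ : 1 / 2 < σ) : Summable fun n => coef σ n ^ 2 := by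
  simp only [coef_sq]
  exact summable_rpow (by linarith)

lemma coef_add (σ τ : ℝ) (n : ℕ) : coef (σ + τ) n = coef τ n * coef σ n := by
  rw [coef, neg_add, Real.rpow_add (by positivity), mul_comm]
  rfl

lemma antitone_coef {σ : ℝ} (hσ : 0 ≤ σ) : Antitone (coef σ) := by
  intro m n h
  unfold coef
  have : (m : ℝ) ≤ n := by exact_mod_cast h
  exact Real.rpow_le_rpow_of_nonpos (by positivity) (by linarith) (by linarith)

lemma tendsto_coef {σ : ℝ} (hσ : 0 < σ) : Tendsto (coef σ) atTop (𝓝 0) :=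
  (tendsto_rpow_neg_atTop hσ).comp
    (tendsto_atTop_add_const_right _ _ tendsto_natCast_atTop_atTop)

section
variable {Ω : Type*} {X : ℕ → Ω → ℝ}

lemma partialSum_eq_wsum (N : ℕ) (σ : ℝ) (ω : Ω) :
    partialSum X N σ ω = wsum X (coef σ) N ω := by
  refine Finset.sum_congr rfl fun n _ => ?_
  rw [coef, Real.rpow_neg (by positivity)]
  field_simp

/-- `F` is a `limUnder`, meaningful only once a limit is known to exist. -/
lemma tendsto_F_of_exists {σ : ℝ} {ω : Ω}
    (h : ∃ c, Tendsto (fun N => wsum X (coef σ) N ω) atTop (𝓝 c)) :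
    Tendsto (fun N => wsum X (coef σ) N ω) atTop (𝓝 (F X σ ω)) := by
  simp only [F, partialSum_eq_wsum]
  exact tendsto_nhds_limUnder h

/-- Dirichlet's test: bounded partial sums at `σ` against the weights `m^{-(τ-σ)}`, which decrease
to zero. -/
lemma exists_tendsto_of_lt {σ τ : ℝ} (hστ : σ < τ) {ω : Ω}
    (h : ∃ c, Tendsto (fun N => wsum X (coef σ) N ω) atTop (𝓝 c)) :
    ∃ c, Tendsto (fun N => wsum X (coef τ) N ω) atTop (𝓝 c) := by
  obtain ⟨c, hc⟩ := h
  obtain ⟨b, hb⟩ := (Metric.isBounded_range_of_tendsto _ hc).exists_norm_le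
  have h1 := (antitone_coef (sub_pos.2 hστ).le).cauchySeq_series_mul_of_tendsto_zero_of_bounded
    (tendsto_coef (sub_pos.2 hστ)) (z := fun n => coef σ n * X n ω) (b := b)
    fun n => hb _ ⟨n, rfl⟩
  obtain ⟨d, hd⟩ := cauchySeq_tendsto_of_complete h1
  refine ⟨d, hd.congr fun N => Finset.sum_congr rfl fun n _ => ?_⟩
  rw [smul_eq_mul, ← mul_assoc, ← coef_add, add_sub_cancel]

/-- Abel's inequality with weights `m^{-(τ-σ)}`, whose first value is 1, so the constant `t` is not
degraded. This controls a whole interval of exponents by one maximal event. -/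
lemma F_le_of_wsum_le {σ τ t : ℝ} (hστ : σ ≤ τ) {ω : Ω}
    (h : ∀ N, wsum X (coef σ) N ω ≤ t)
    (hτ : Tendsto (fun N => wsum X (coef τ) N ω) atTop (𝓝 (F X τ ω))) : F X τ ω ≤ t := by
  refine le_of_tendsto' hτ fun N => ?_
  have h1 := sum_mul_le_of_antitone (antitone_coef (sub_nonneg.2 hστ)) (coef_nonneg _) h N
  simp only [← mul_assoc, ← coef_add, add_sub_cancel] at h1
  simpa [wsum, coef] using h1

end

lemma ae_eventually_notMem_of_summable {Ω : Type*} [MeasurableSpace Ω] {P : Measure Ω}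
    [IsFiniteMeasure P] {s : ℕ → Set Ω} {g : ℕ → ℝ} (hg : Summable g)
    (h : ∀ᶠ k in atTop, P (s k) ≤ ENNReal.ofReal (g k)) : ∀ᵐ ω ∂P, ∀ᶠ k in atTop, ω ∉ s k := by
  refine ae_eventually_notMem ?_
  have h1 : Summable fun k => P.real (s k) := by
    refine Summable.of_norm_bounded_eventually_nat hg.abs ?_
    filter_upwards [h] with k hk
    rw [Real.norm_eq_abs, abs_of_nonneg measureReal_nonneg]
    refine ENNReal.toReal_le_of_le_ofReal (abs_nonneg _) (hk.trans ?_)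
    exact ENNReal.ofReal_le_ofReal (le_abs_self _)
  have h2 : ∀ k, P (s k) = ENNReal.ofReal (P.real (s k)) := fun k => (ofReal_measureReal).symm
  simp only [h2]
  exact h1.tsum_ofReal_ne_top

lemma tendsto_one_div_two_mul_sub_one :
    Tendsto (fun σ : ℝ => 1 / (2 * σ - 1)) (𝓝[>] (1 / 2 : ℝ)) atTop := by
  simp only [one_div]
  refine tendsto_inv_nhdsGT_zero.comp (tendsto_nhdsWithin_iff.2 ⟨?_, ?_⟩)
  · have : Continuous fun σ : ℝ => 2 * σ - 1 := by fun_prop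
    have h := this.tendsto (1 / 2)
    norm_num at h ⊢
    exact h.mono_left nhdsWithin_le_nhds
  · filter_upwards [self_mem_nhdsWithin] with σ hσ
    simp only [Set.mem_Ioi] at *
    linarith

lemma eventually_lilNorm_pos {α : Type*} {l : Filter α} {f : α → ℝ} (hf : Tendsto f l atTop) :
    ∀ᶠ x in l, 0 < lilNorm (f x) := by
  filter_upwards [hf.eventually_gt_atTop 0, (tendsto_loglog hf).eventually_gt_atTop 0] with x h1 h2
  exact Real.sqrt_pos.2 (by positivity)

lemma lilNorm_sq {v : ℝ} (hv : 0 ≤ v) (h : 0 ≤ Real.log (Real.log v)) :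
    lilNorm v ^ 2 = 2 * v * Real.log (Real.log v) :=
  Real.sq_sqrt (by positivity)

lemma tendsto_pow_nat_atTop {θ : ℝ} (hθ : 1 < θ) {b : ℕ → ℕ} (hb : Tendsto b atTop atTop) :
    Tendsto (fun k => θ ^ b k) atTop atTop :=
  (tendsto_pow_atTop_atTop_of_one_lt hθ).comp hb

/-! ### Almost sure convergence, second moment and upper bound. -/

section
variable {Ω : Type*} [MeasurableSpace Ω] {P : Measure Ω} [IsProbabilityMeasure P]
  {X : ℕ → Ω → ℝ}

namespace IsRademacher

lemma ae_tendsto_F (hX : IsRademacher P X) : ∀ᵐ ω ∂P, ∀ σ : ℝ, 1 / 2 < σ →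
    Tendsto (fun N => wsum X (coef σ) N ω) atTop (𝓝 (F X σ ω)) := by
  -- Countably many exponents tending to `1/2` suffice, since convergence passes to larger ones.
  have h : ∀ᵐ ω ∂P, ∀ m : ℕ,
      ∃ c, Tendsto (fun N => wsum X (coef (1 / 2 + 1 / ((m : ℝ) + 1))) N ω) atTop (𝓝 c) :=
    ae_all_iff.2 fun m => hX.ae_exists_tendsto_wsum (summable_coef_sq (by simp; positivity))
  filter_upwards [h] with ω hω σ hσ
  obtain ⟨m, hm⟩ := exists_nat_one_div_lt (sub_pos.2 hσ)
  exact tendsto_F_of_exists (exists_tendsto_of_lt (by linarith) (hω m))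

lemma memLp_F (hX : IsRademacher P X) {σ : ℝ} (hσ : 1 / 2 < σ) : MemLp (F X σ) 2 P :=
  (hX.memLp_and_integral_sq_of_tendsto (summable_coef_sq hσ)
    (hX.ae_tendsto_F.mono fun _ h => h σ hσ)).1

lemma secondMoment_eq (hX : IsRademacher P X) {σ : ℝ} (hσ : 1 / 2 < σ) :
    secondMoment P X σ = ∑' n : ℕ, ((n : ℝ) + 1) ^ (-1 - (2 * σ - 1)) := by
  rw [secondMoment, (hX.memLp_and_integral_sq_of_tendsto (summable_coef_sq hσ)
    (hX.ae_tendsto_F.mono fun _ h => h σ hσ)).2]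
  simp only [coef_sq]

lemma tendsto_secondMoment (hX : IsRademacher P X) :
    Tendsto (fun σ : ℝ => secondMoment P X σ / (1 / (2 * σ - 1))) (𝓝[>] (1 / 2 : ℝ)) (𝓝 1) := by
  have h1 : Tendsto (fun σ : ℝ => 1 + (2 * σ - 1)) (𝓝[>] (1 / 2 : ℝ)) (𝓝 1) := by
    have : Continuous fun σ : ℝ => 1 + (2 * σ - 1) := by fun_prop
    have h := this.tendsto (1 / 2)
    norm_num at h ⊢
    exact h.mono_left nhdsWithin_le_nhds
  refine tendsto_of_tendsto_of_tendsto_of_le_of_le' tendsto_const_nhds h1 ?_ ?_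
  · filter_upwards [self_mem_nhdsWithin] with σ (hσ : 1 / 2 < σ)
    have hu : 0 < 2 * σ - 1 := by linarith
    rw [hX.secondMoment_eq hσ, le_div_iff₀ (by positivity), one_mul]
    exact le_tsum_rpow hu
  · filter_upwards [self_mem_nhdsWithin] with σ (hσ : 1 / 2 < σ)
    have hu : 0 < 2 * σ - 1 := by linarith
    rw [hX.secondMoment_eq hσ, div_le_iff₀ (by positivity)]
    refine (tsum_rpow_le hu).trans (le_of_eq ?_)
    field_simp
    ring

/-- The upper half of the law of the iterated logarithm. -/
lemma ae_eventually_F_le (hX : IsRademacher P X) {c : ℝ} (hc : 1 < c) :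
    ∀ᵐ ω ∂P, ∀ᶠ σ in 𝓝[>] (1 / 2 : ℝ), F X σ ω ≤ c * lilNorm (1 / (2 * σ - 1)) := by
  -- One factor `θ` makes the tail probabilities summable, the other pays for passing from `θ^(n+1)`
  -- to a general `1/(2σ-1)`.
  obtain ⟨θ, hθ, rfl⟩ : ∃ θ : ℝ, 1 < θ ∧ θ * θ = c :=
    ⟨√c, Real.lt_sqrt_of_sq_lt (by simpa using hc), Real.mul_self_sqrt (by linarith)⟩
  have hθ0 : 0 < θ := by linarith
  have hw : Tendsto (fun k : ℕ => θ ^ k) atTop atTop := tendsto_pow_atTop_atTop_of_one_lt hθ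
  set s : ℕ → ℝ := fun k => 1 / 2 + 1 / (2 * θ ^ k) with hs
  have hsu : ∀ k, 2 * s k - 1 = 1 / θ ^ k := fun k => by
    simp only [hs]
    field_simp
    ring
  have hBC : ∀ᵐ ω ∂P, ∀ᶠ k in atTop,
      ω ∉ {ω | ∃ N, θ * lilNorm (θ ^ k) ≤ wsum X (coef (s k)) N ω} := by
    have hsum : Summable fun k : ℕ => (Real.log θ) ^ (-θ) * (k : ℝ) ^ (-θ) :=
      (Real.summable_nat_rpow.2 (by linarith)).mul_left _
    refine ae_eventually_notMem_of_summable hsum ?_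
    filter_upwards [eventually_lilNorm_pos hw, (tendsto_loglog hw).eventually_gt_atTop 0,
      -- Ensures `1 + θ^k ≤ θ * θ^k`, which costs one of the two factors `θ` in the exponent and
      -- leaves `(log θ^k)^(-θ)`.
      hw.eventually_ge_atTop (1 / (θ - 1)), eventually_gt_atTop 0] with k h1 h2 h3 h4
    have hwk : 0 < θ ^ k := by positivity
    refine (hX.measure_exists_le_wsum (coef (s k)) (v := 1 + θ ^ k) (by positivity)
      (mul_pos hθ0 h1) fun N => ?_).trans (ENNReal.ofReal_le_ofReal ?_)
    · simp only [coef_sq, hsu]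
      simpa using sum_range_rpow_le (u := 1 / θ ^ k) (by positivity) N
    · have hk : (0 : ℝ) < k := by exact_mod_cast h4
      have h5 : Real.log (θ ^ k) = Real.log θ * k := by rw [Real.log_pow, mul_comm]
      have h6 := Real.log_pos hθ
      rw [← Real.mul_rpow h6.le hk.le, ← h5, Real.rpow_def_of_pos (by rw [h5]; positivity),
        Real.exp_le_exp, mul_pow, lilNorm_sq hwk.le h2.le, div_le_iff₀ (by positivity)]
      rw [div_le_iff₀ (by linarith)] at h3
      have h7 := mul_le_mul_of_nonneg_left (show 1 + θ ^ k ≤ θ * θ ^ k by linarith)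
        (mul_pos hθ0 h2).le
      linarith
  filter_upwards [hBC, hX.ae_tendsto_F] with ω h1 h2
  obtain ⟨K, hK⟩ := eventually_atTop.1 h1
  have hratio := (tendsto_lilNorm_div_lilNorm hθ0 tendsto_one_div_two_mul_sub_one
    (f := fun σ => θ * (1 / (2 * σ - 1))) (by
      refine tendsto_const_nhds.congr' ?_
      filter_upwards [tendsto_one_div_two_mul_sub_one.eventually_gt_atTop 0] with σ h
      rw [mul_div_cancel_right₀ _ h.ne'])).eventually_lt_const
      (show √θ < θ by rw [Real.sqrt_lt' hθ0]; nlinarith)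
  filter_upwards [hratio, eventually_lilNorm_pos tendsto_one_div_two_mul_sub_one,
    tendsto_one_div_two_mul_sub_one.eventually_ge_atTop (Real.exp 1),
    tendsto_one_div_two_mul_sub_one.eventually_ge_atTop 1,
    tendsto_one_div_two_mul_sub_one.eventually_ge_atTop (θ ^ K), self_mem_nhdsWithin]
    with σ g1 g2 g3 g4 g5 (g6 : 1 / 2 < σ)
  -- The exponent `s (n + 1)` lies just to the left of `σ`, the side from which `F_le_of_wsum_le`
  -- propagates bounds.
  obtain ⟨n, hn1, hn2⟩ := exists_nat_pow_near g4 hθ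
  have hKn : K ≤ n + 1 := by
    by_contra! h
    have := pow_le_pow_right₀ hθ.le h.le
    linarith
  have hbound : ∀ N, wsum X (coef (s (n + 1))) N ω ≤ θ * lilNorm (θ ^ (n + 1)) := by
    intro N
    have := hK (n + 1) hKn
    simp only [not_exists, not_le] at this
    exact (this N).le
  have hsσ : s (n + 1) ≤ σ := by
    have h3 : 1 / θ ^ (n + 1) ≤ 2 * σ - 1 := by
      rw [div_lt_iff₀ (by linarith)] at hn2
      rw [div_le_iff₀ (by positivity)]
      linarith
    have := hsu (n + 1)
    linarith
  have h4 := F_le_of_wsum_le hsσ hbound (h2 σ g6)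
  have h5 : lilNorm (θ ^ (n + 1)) ≤ lilNorm (θ * (1 / (2 * σ - 1))) := by
    refine lilNorm_mono (g3.trans hn2.le) ?_
    rw [pow_succ, mul_comm]
    gcongr
  rw [div_lt_iff₀ g2] at g1
  calc F X σ ω ≤ θ * lilNorm (θ ^ (n + 1)) := h4
    _ ≤ θ * (θ * lilNorm (1 / (2 * σ - 1))) := by
      gcongr
      linarith
    _ = _ := by ring

end IsRademacher
end

/-! ### Splitting the series into a block and a remainder -/

/-- The coefficients with index in `[A, B)`. -/
noncomputable def blockCoef (A B : ℕ) (σ : ℝ) (n : ℕ) : ℝ :=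
  if n ∈ Finset.Ico A B then coef σ n else 0

/-- The coefficients with index outside `[A, B)`. -/
noncomputable def restCoef (A B : ℕ) (σ : ℝ) (n : ℕ) : ℝ :=
  if n ∈ Finset.Ico A B then 0 else coef σ n

lemma blockCoef_add_restCoef (A B : ℕ) (σ : ℝ) (n : ℕ) :
    blockCoef A B σ n + restCoef A B σ n = coef σ n := by
  unfold blockCoef restCoef
  split_ifs <;> simp

lemma blockCoef_sq_add_restCoef_sq (A B : ℕ) (σ : ℝ) (n : ℕ) :
    blockCoef A B σ n ^ 2 + restCoef A B σ n ^ 2 = coef σ n ^ 2 := by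
  unfold blockCoef restCoef
  split_ifs <;> simp

lemma blockCoef_sq_le_one {A B : ℕ} {σ : ℝ} (hσ : 1 / 2 < σ) (n : ℕ) :
    blockCoef A B σ n ^ 2 ≤ 1 := by
  have := blockCoef_sq_add_restCoef_sq A B σ n
  nlinarith [coef_sq_le_one hσ n, sq_nonneg (restCoef A B σ n)]

lemma sum_blockCoef_sq_le (A B : ℕ) (σ : ℝ) (N : ℕ) :
    ∑ n ∈ Finset.range N, blockCoef A B σ n ^ 2 ≤ ∑ n ∈ Finset.range B, blockCoef A B σ n ^ 2 := by
  rcases le_total N B with h | h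
  · exact Finset.sum_le_sum_of_subset_of_nonneg (Finset.range_subset_range.2 h)
      fun _ _ _ => sq_nonneg _
  · refine (Finset.sum_subset (Finset.range_subset_range.2 h) fun n _ hn => ?_).ge
    have : n ∉ Finset.Ico A B := by simp at hn ⊢; omega
    simp [blockCoef, this]

lemma sum_restCoef_sq_le {A B : ℕ} (hB : 1 ≤ B) {σ : ℝ} (hσ : 1 / 2 < σ) (N : ℕ) :
    ∑ n ∈ Finset.range N, restCoef A B σ n ^ 2 ≤
      1 + Real.log A + (B : ℝ) ^ (-(2 * σ - 1)) / (2 * σ - 1) := by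
  have hu : 0 < 2 * σ - 1 := by linarith
  have h1 : ∑ n ∈ Finset.range N, restCoef A B σ n ^ 2 ≤
      ∑ n ∈ Finset.range A ∪ Finset.Ico B N, coef σ n ^ 2 := by
    have h2 : ∑ n ∈ Finset.range N, restCoef A B σ n ^ 2 =
        ∑ n ∈ (Finset.range N).filter (· ∉ Finset.Ico A B), coef σ n ^ 2 := by
      rw [Finset.sum_filter]
      refine Finset.sum_congr rfl fun n _ => ?_
      unfold restCoef
      split_ifs <;> simp_all
    rw [h2]
    refine Finset.sum_le_sum_of_subset_of_nonneg ?_ fun _ _ _ => sq_nonneg _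
    intro n
    simp
    omega
  refine h1.trans ((le_add_of_nonneg_right (Finset.sum_nonneg fun _ _ => sq_nonneg _)).trans
    (Finset.sum_union_inter (s₁ := Finset.range A) (s₂ := Finset.Ico B N)
      (f := fun n => coef σ n ^ 2)).le |>.trans ?_)
  simp only [coef_sq]
  exact add_le_add (sum_range_rpow_le_log hu A) (sum_Ico_rpow_le hu hB N)

/-- The total variance is at least `1/(2σ-1)`, and what the rest does not use belongs to the block.
-/
lemma le_sum_blockCoef_sq {A B : ℕ} {σ r : ℝ} (hσ : 1 / 2 < σ)
    (hr : ∀ N, ∑ n ∈ Finset.range N, restCoef A B σ n ^ 2 ≤ r) :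
    1 / (2 * σ - 1) - r ≤ ∑ n ∈ Finset.range B, blockCoef A B σ n ^ 2 := by
  have h1 := le_tsum_rpow (u := 2 * σ - 1) (by linarith)
  simp only [← coef_sq] at h1
  have h2 : ∑' n, coef σ n ^ 2 ≤ ∑ n ∈ Finset.range B, blockCoef A B σ n ^ 2 + r := by
    refine Real.tsum_le_of_sum_range_le (fun _ => sq_nonneg _) fun N => ?_
    simp only [← blockCoef_sq_add_restCoef_sq A B, Finset.sum_add_distrib]
    exact add_le_add (sum_blockCoef_sq_le A B σ N) (hr N)
  linarith

section
variable {Ω : Type*} {X : ℕ → Ω → ℝ}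

lemma le_F_of_block {A B : ℕ} {σ t : ℝ} {ω : Ω}
    (hF : Tendsto (fun N => wsum X (coef σ) N ω) atTop (𝓝 (F X σ ω)))
    (ht : ∀ N, wsum X (fun n => -restCoef A B σ n) N ω ≤ t) :
    wsum X (blockCoef A B σ) B ω - t ≤ F X σ ω := by
  refine ge_of_tendsto hF ?_
  filter_upwards [eventually_ge_atTop B] with N hN
  have h1 : wsum X (blockCoef A B σ) N ω = wsum X (blockCoef A B σ) B ω := by
    refine (Finset.sum_subset (Finset.range_subset_range.2 hN) fun n _ hn => ?_).symm
    have : n ∉ Finset.Ico A B := by simp at hn ⊢; omega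
    simp [blockCoef, this]
  have h2 : wsum X (coef σ) N ω = wsum X (blockCoef A B σ) N ω -
      wsum X (fun n => -restCoef A B σ n) N ω := by
    simp only [wsum, ← blockCoef_add_restCoef A B, ← Finset.sum_sub_distrib]
    exact Finset.sum_congr rfl fun n _ => by ring
  have := ht N
  linarith

lemma measurableSet_le_wsum_blockCoef (A B : ℕ) (σ c : ℝ) :
    MeasurableSet[⨆ n ∈ Set.Ico A B, MeasurableSpace.comap (X n) inferInstance]
      {ω | c ≤ wsum X (blockCoef A B σ) B ω} := by
  have h : Measurable[⨆ n ∈ Set.Ico A B, MeasurableSpace.comap (X n) inferInstance]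
      (wsum X (blockCoef A B σ) B) := by
    refine Finset.measurable_sum _ fun n _ => ?_
    by_cases hn : n ∈ Finset.Ico A B
    · have h1 : Measurable[⨆ n ∈ Set.Ico A B, MeasurableSpace.comap (X n) inferInstance] (X n) :=
        (comap_measurable (X n)).mono (le_iSup₂_of_le n (by simpa using hn) le_rfl) le_rfl
      exact h1.const_mul _
    · simp only [blockCoef, hn, if_false, zero_mul]
      exact measurable_const
  exact h measurableSet_Ici

end

/-! ### Lower bound by independent blocks. -/

section
variable {Ω : Type*} [MeasurableSpace Ω] {P : Measure Ω} [IsProbabilityMeasure P]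
  {X : ℕ → Ω → ℝ}

namespace IsRademacher

lemma le_measure_sqrt_le_wsum (hX : IsRademacher P X) {δ : ℝ} (hδ : 0 < δ) (hδ1 : δ < 1)
    (b : ℕ → ℝ) (N : ℕ) {V L : ℝ} (hV : ∑ n ∈ Finset.range N, b n ^ 2 = V) (hV0 : 0 < V)
    (hL : 0 < L) (hb : ∀ n < N, b n ^ 2 * (2 * L) ≤ δ ^ 2 * V)
    (hL4 : 4 ≤ Real.exp (δ ^ 2 * L / 8)) :
    ENNReal.ofReal (1 / 2 * Real.exp (-L)) ≤
      P {ω | (1 - δ) * √(2 * L * V / (1 + 3 * δ)) ≤ wsum X b N ω} := by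
  -- Chosen so that `(1 + 3δ) W / 2 = L`: the coefficients are rescaled to variance `W`, and
  -- `le_measure_le_wsum` then yields exactly `exp (-L)`.
  set W := 2 * L / (1 + 3 * δ) with hW
  have hW0 : 0 < W := by positivity
  set c := √(W / V) with hc
  have hc0 : 0 < c := Real.sqrt_pos.2 (by positivity)
  have hc2 : c ^ 2 = W / V := Real.sq_sqrt (by positivity)
  have hWL : W ≤ 2 * L := div_le_self (by positivity) (by linarith)
  have hLW : L / 2 ≤ W := by
    rw [hW, le_div_iff₀ (by positivity)]
    nlinarith
  have h := hX.le_measure_le_wsum hδ hδ1 (fun n => c * b n) N (V := W) ?_ ?_ ?_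
  · convert h using 2
    · congr 2
      rw [hW]
      field_simp
    · ext ω
      have h1 : wsum X (fun n => c * b n) N ω = c * wsum X b N ω := by
        simp [wsum, Finset.mul_sum, mul_assoc]
      have h2 : √(2 * L * V / (1 + 3 * δ)) = W / c := by
        rw [hc, Real.sqrt_div' _ hV0.le, div_div_eq_mul_div,
          show 2 * L * V / (1 + 3 * δ) = W * V by rw [hW]; ring, Real.sqrt_mul hW0.le,
          eq_div_iff (Real.sqrt_pos.2 hW0).ne', mul_right_comm, Real.mul_self_sqrt hW0.le]
      simp only [Set.mem_ofPred_eq]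
      rw [h1, h2, ← mul_div_assoc, div_le_iff₀ hc0, mul_comm c]
  · intro n hn
    rw [mul_pow, hc2, div_mul_eq_mul_div, div_le_iff₀ hV0]
    refine le_trans ?_ (hb n hn)
    rw [mul_comm]
    gcongr
  · simp only [mul_pow, ← Finset.mul_sum, hV, hc2]
    field_simp
  · refine hL4.trans (Real.exp_le_exp.2 ?_)
    nlinarith [sq_nonneg δ]

/-- The second Borel–Cantelli lemma for disjoint blocks with harmonic probabilities. -/
lemma ae_frequently_le_blocks (hX : IsRademacher P X) {N : ℕ → ℕ} (hN : Monotone N)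
    (s c : ℕ → ℝ) {C : ℝ} (hC : 0 < C)
    (h : ∀ᶠ k : ℕ in atTop, ENNReal.ofReal (C / ((k : ℝ) + 1)) ≤
      P {ω | c k ≤ wsum X (blockCoef (N k) (N (k + 1)) (s k)) (N (k + 1)) ω}) :
    ∀ᵐ ω ∂P, ∃ᶠ k in atTop, c k ≤ wsum X (blockCoef (N k) (N (k + 1)) (s k)) (N (k + 1)) ω := by
  set G : ℕ → Set Ω := fun k =>
    {ω | c k ≤ wsum X (blockCoef (N k) (N (k + 1)) (s k)) (N (k + 1)) ω} with hG
  have hGm : ∀ k, MeasurableSet (G k) := fun k =>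
    measurableSet_le measurable_const (hX.measurable_wsum _ _)
  have hind : iIndepSet G P := hX.iIndepSet_of_blocks (B := fun k => Set.Ico (N k) (N (k + 1)))
    hN.pairwise_disjoint_on_Ico_succ fun k => measurableSet_le_wsum_blockCoef _ _ _ _
  have hsum : ∑' k, P (G k) = ⊤ := by
    by_contra hne
    have h1 : Summable fun k => P.real (G k) := ENNReal.summable_toReal hne
    have h2 : Summable fun k : ℕ => C / ((k : ℝ) + 1) := by
      refine Summable.of_norm_bounded_eventually_nat h1 ?_
      filter_upwards [h] with k hk
      rw [Real.norm_eq_abs, abs_of_pos (by positivity)]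
      exact (ENNReal.ofReal_le_iff_le_toReal (measure_ne_top _ _)).1 hk
    have h3 : Summable fun k : ℕ => 1 / ((k : ℝ) + 1) := by
      refine (h2.mul_left C⁻¹).congr fun k => ?_
      field_simp
    refine Real.not_summable_one_div_natCast ((summable_nat_add_iff 1).1 (h3.congr fun k => ?_))
    push_cast
    rfl
  have h1 := measure_limsup_eq_one hGm hind hsum
  rw [← mem_ae_iff_prob_eq_one (MeasurableSet.measurableSet_limsup hGm)] at h1
  filter_upwards [h1] with ω hω
  exact mem_limsup_iff_frequently_mem.1 hω

/-- The lower half of the law of the iterated logarithm. -/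
lemma ae_frequently_le_F (hX : IsRademacher P X) {c : ℝ} (hc : c < 1) :
    ∀ᵐ ω ∂P, ∃ᶠ σ in 𝓝[>] (1 / 2 : ℝ), c * lilNorm (1 / (2 * σ - 1)) ≤ F X σ ω := by
  obtain ⟨δ, hδ, hδ1, hcδ⟩ : ∃ δ : ℝ, 0 < δ ∧ δ < 1 ∧
      c < (1 - δ) * √((1 - δ) / (1 + 3 * δ)) - δ := by
    have h1 : ContinuousAt (fun δ : ℝ => (1 - δ) * √((1 - δ) / (1 + 3 * δ)) - δ) 0 := by
      refine (ContinuousAt.mul (by fun_prop) (ContinuousAt.sqrt ?_)).sub continuousAt_id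
      exact ContinuousAt.div (by fun_prop) (by fun_prop) (by norm_num)
    have h2 := h1.eventually_const_lt (u := c) (by simpa using hc)
    have h3 := (h2.filter_mono (nhdsWithin_le_nhds (s := Set.Ioi 0))).and
      (Ioo_mem_nhdsGT (zero_lt_one (α := ℝ)))
    obtain ⟨δ, h4, h5⟩ := h3.exists
    exact ⟨δ, h5.1, h5.2, h4⟩
  -- With rest variance at most `ρ w`, the maximal inequality at level `δ * lilNorm w` gives `exp
  -- (-2 log log w)`, of order `k^{-2}`.
  set ρ := δ ^ 2 / 2 with hρ
  have hρ0 : 0 < ρ := by positivity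
  have hρδ : ρ ≤ δ := by nlinarith
  obtain ⟨m, hm⟩ := exists_nat_ge (max 2 (3 / ρ))
  have hm2 : (2 : ℝ) ≤ m := (le_max_left _ _).trans hm
  have hmρ : 3 ≤ ρ * m := by
    have := (le_max_right _ _).trans hm
    rw [div_le_iff₀ hρ0] at this
    linarith
  have hm0 : (0 : ℝ) < m := by linarith
  have hm1 : (1 : ℝ) < m := by linarith
  have hlm : 0 < Real.log m := Real.log_pos hm1
  set w : ℕ → ℝ := fun k => (m : ℝ) ^ (2 * k + 1) with hwdef
  have hw0 : ∀ k, 0 < w k := fun k => by positivity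
  have hw : Tendsto w atTop atTop :=
    tendsto_pow_nat_atTop hm1 (tendsto_atTop_mono (fun k => by simp only [id]; omega) tendsto_id)
  set N : ℕ → ℕ := fun k => ⌈Real.exp ((m : ℝ) ^ (2 * k))⌉₊ with hNdef
  have hNmono : Monotone N := by
    intro j k hjk
    refine Nat.ceil_mono (Real.exp_le_exp.2 (pow_le_pow_right₀ hm1.le (by omega)))
  have hNle : ∀ k, Real.exp ((m : ℝ) ^ (2 * k)) ≤ N k := fun k => Nat.le_ceil _
  have hN1 : ∀ k, 1 ≤ N k := fun k => Nat.one_le_ceil_iff.2 (Real.exp_pos _)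
  set s : ℕ → ℝ := fun k => 1 / 2 + 1 / (2 * w k) with hs
  have hsu : ∀ k, 2 * s k - 1 = 1 / w k := fun k => by
    have := hw0 k
    simp only [hs]
    field_simp
    ring
  have hs2 : ∀ k, 1 / 2 < s k := fun k => by
    have := hw0 k
    simp only [hs]
    linarith [show 0 < 1 / (2 * w k) by positivity]
  have hrest : ∀ k, 1 ≤ k → ∀ M,
      ∑ n ∈ Finset.range M, restCoef (N k) (N (k + 1)) (s k) n ^ 2 ≤ ρ * w k := by
    intro k hk M
    refine (sum_restCoef_sq_le (hN1 (k + 1)) (hs2 k) M).trans ?_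
    rw [hsu]
    have hwm : w k = m * (m : ℝ) ^ (2 * k) := pow_succ' _ _
    have h2 : (2 : ℝ) ≤ (m : ℝ) ^ (2 * k) :=
      hm2.trans (le_self_pow₀ hm1.le (by omega))
    have h3 : Real.log (N k) ≤ 1 + (m : ℝ) ^ (2 * k) := by
      have h4 : (N k : ℝ) ≤ 2 * Real.exp ((m : ℝ) ^ (2 * k)) := by
        have := (Nat.ceil_lt_add_one (Real.exp_pos ((m : ℝ) ^ (2 * k))).le).le
        have h5 : 1 ≤ Real.exp ((m : ℝ) ^ (2 * k)) := Real.one_le_exp (by positivity)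
        simp only [hNdef]
        linarith
      refine (Real.log_le_log (by exact_mod_cast hN1 k) h4).trans ?_
      rw [Real.log_mul (by norm_num) (Real.exp_pos _).ne', Real.log_exp]
      have := Real.log_le_sub_one_of_pos (show (0 : ℝ) < 2 by norm_num)
      linarith
    -- Since `m^(2k+2) / w k = m`, the left side is at most `exp (-m)`.
    have h4 : (N (k + 1) : ℝ) ^ (-(1 / w k)) ≤ (m : ℝ)⁻¹ := by
      refine (Real.rpow_le_rpow_of_nonpos (Real.exp_pos _) (hNle (k + 1))
        (by have := hw0 k; simp; positivity)).trans ?_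
      rw [← Real.exp_mul]
      have h5 : (m : ℝ) ^ (2 * (k + 1)) * -(1 / w k) = -m := by
        have h6 : (m : ℝ) ^ (2 * (k + 1)) = m * w k := by
          simp only [hwdef]
          ring
        have := (hw0 k).ne'
        rw [h6]
        field_simp
      rw [h5, Real.exp_neg]
      exact inv_anti₀ hm0 (by linarith [Real.add_one_le_exp (m : ℝ)])
    have h6 : (N (k + 1) : ℝ) ^ (-(1 / w k)) / (1 / w k) ≤ (m : ℝ) ^ (2 * k) := by
      rw [div_div_eq_mul_div, div_one]
      refine (mul_le_mul_of_nonneg_right h4 (hw0 k).le).trans (le_of_eq ?_)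
      rw [hwm]
      field_simp
    -- The rest contributes at most `2 + 2 m^(2k)`, and `2 ≤ m^(2k)` because `k ≥ 1`.
    have h7 : 3 * (m : ℝ) ^ (2 * k) ≤ ρ * w k := by
      rw [hwm, ← mul_assoc]
      gcongr
    linarith
  set L : ℕ → ℝ := fun k => Real.log (Real.log (w k)) with hLdef
  have hL : Tendsto L atTop atTop := tendsto_loglog hw
  have hexpL : ∀ k, Real.exp (L k) = (2 * k + 1) * Real.log m := by
    intro k
    have h1 : Real.log (w k) = (2 * k + 1) * Real.log m := by
      simp only [hwdef, Real.log_pow]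
      push_cast
      rfl
    simp only [hLdef]
    rw [h1, Real.exp_log (by positivity)]
  set κ := (1 - δ) * √((1 - δ) / (1 + 3 * δ)) with hκ
  have hrestBC : ∀ᵐ ω ∂P, ∀ᶠ k in atTop, ω ∉ {ω | ∃ M, δ * lilNorm (w k) ≤
      wsum X (fun n => -restCoef (N k) (N (k + 1)) (s k) n) M ω} := by
    have hsum : Summable fun k : ℕ => (Real.log m)⁻¹ ^ 2 * (1 / (k : ℝ) ^ 2) :=
      (Real.summable_one_div_nat_pow.2 one_lt_two).mul_left _
    refine ae_eventually_notMem_of_summable hsum ?_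
    filter_upwards [eventually_ge_atTop 1, eventually_lilNorm_pos hw, hL.eventually_gt_atTop 0]
      with k hk h1 h2
    refine (hX.measure_exists_le_wsum _ (mul_pos hρ0 (hw0 k)) (mul_pos hδ h1) fun M => ?_).trans
      (ENNReal.ofReal_le_ofReal ?_)
    · simpa only [neg_sq] using hrest k hk M
    · have hwk := hw0 k
      have hk0 : (0 : ℝ) < k := by exact_mod_cast hk
      rw [mul_pow, lilNorm_sq hwk.le h2.le]
      have h3 : -(δ ^ 2 * (2 * w k * Real.log (Real.log (w k)))) / (2 * (ρ * w k)) =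
          -(L k + L k) := by
        rw [hρ]
        simp only [hLdef]
        field_simp
        ring
      rw [h3, Real.exp_neg, Real.exp_add, hexpL]
      have h4 : (k : ℝ) * Real.log m ≤ (2 * k + 1) * Real.log m := by
        gcongr
        linarith
      have h5 : (Real.log m)⁻¹ ^ 2 * (1 / (k : ℝ) ^ 2) =
          ((k : ℝ) * Real.log m * (k * Real.log m))⁻¹ := by
        field_simp
      rw [h5]
      gcongr
  have hLw : Tendsto (fun k => L k / w k) atTop (𝓝 0) := by
    have h1 : Tendsto (fun x : ℝ => Real.log x / x) atTop (𝓝 0) := by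
      simpa using Real.isLittleO_log_id_atTop.tendsto_div_nhds_zero
    have h2 : Tendsto (fun k => Real.log (w k) / w k) atTop (𝓝 0) := h1.comp hw
    refine squeeze_zero' ?_ ?_ h2
    · filter_upwards [hL.eventually_ge_atTop 0] with k hk
      exact div_nonneg hk (hw0 k).le
    · filter_upwards [hw.eventually_gt_atTop 1] with k hk
      have hlw := Real.log_pos hk
      have := Real.log_le_sub_one_of_pos hlw
      have h3 := hw0 k
      gcongr
      simp only [hLdef]
      linarith
  have hblock := hX.ae_frequently_le_blocks hNmono s (fun k => κ * lilNorm (w k))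
    (C := 1 / (4 * Real.log m)) (by positivity) (by
      -- Threshold for `L/w`: with `V ≥ (1 - δ) w` it gives `2L ≤ δ² V`, the smallness needed of
      -- coefficients bounded by 1.
      have hpos : 0 < δ ^ 2 * (1 - δ) / 2 := by
        have : 0 < 1 - δ := by linarith
        positivity
      filter_upwards [eventually_ge_atTop 1, hL.eventually_gt_atTop 0,
        hLw.eventually_lt_const hpos, hL.eventually_ge_atTop (8 * Real.log 4 / δ ^ 2)]
        with k hk hL0 hLw hL4
      have hwk := hw0 k
      set V := ∑ n ∈ Finset.range (N (k + 1)), blockCoef (N k) (N (k + 1)) (s k) n ^ 2 with hV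
      have hVw : (1 - δ) * w k ≤ V := by
        have h1 := le_sum_blockCoef_sq (hs2 k) (hrest k hk)
        rw [hsu, one_div_one_div] at h1
        nlinarith
      have hV0 : 0 < V := lt_of_lt_of_le (mul_pos (by linarith) hwk) hVw
      have h2 := hX.le_measure_sqrt_le_wsum hδ hδ1 _ _ hV.symm hV0 hL0 (fun n _ => ?_) ?_
      · refine le_trans (ENNReal.ofReal_le_ofReal ?_) (h2.trans (measure_mono ?_))
        · rw [Real.exp_neg, hexpL]
          have h3 : 1 / (4 * Real.log m) / ((k : ℝ) + 1) =
              1 / 2 * ((2 * k + 2) * Real.log m)⁻¹ := by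
            field_simp
            ring
          rw [h3]
          gcongr
          norm_num
        · intro ω hω
          rw [Set.mem_ofPred_eq] at hω ⊢
          refine le_trans ?_ hω
          rw [hκ, mul_assoc, lilNorm, ← Real.sqrt_mul (div_nonneg (by linarith) (by linarith))]
          refine mul_le_mul_of_nonneg_left (Real.sqrt_le_sqrt ?_) (by linarith)
          rw [div_mul_eq_mul_div]
          refine div_le_div_of_nonneg_right ?_ (by positivity)
          change _ * (2 * w k * L k) ≤ _
          nlinarith
      · have h3 := blockCoef_sq_le_one (A := N k) (B := N (k + 1)) (hs2 k) n
        rw [div_lt_iff₀ hwk] at hLw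
        have h4 : blockCoef (N k) (N (k + 1)) (s k) n ^ 2 * (2 * L k) ≤ 1 * (2 * L k) := by
          gcongr
        have h5 := mul_le_mul_of_nonneg_left hVw (sq_nonneg δ)
        linarith
      · rw [← Real.log_le_iff_le_exp (by norm_num)]
        rw [div_le_iff₀ (by positivity)] at hL4
        linarith)
  have hslim : Tendsto s atTop (𝓝[>] (1 / 2 : ℝ)) := by
    refine tendsto_nhdsWithin_iff.2 ⟨?_, Eventually.of_forall hs2⟩
    have h1 := ((hw.const_mul_atTop (two_pos (α := ℝ))).inv_tendsto_atTop).const_add (1 / 2)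
    rw [add_zero] at h1
    exact h1.congr fun k => by simp [hs]
  filter_upwards [hrestBC, hblock, hX.ae_tendsto_F] with ω h1 h2 h3
  refine hslim.frequently ((h2.and_eventually (h1.and (eventually_lilNorm_pos hw))).mono ?_)
  rintro k ⟨h4, h5, h6⟩
  simp only [not_exists, not_le] at h5
  have h7 := le_F_of_block (h3 _ (hs2 k)) fun M => (h5 M).le
  rw [hsu, one_div_one_div]
  nlinarith

end IsRademacher
end

/-! ### The law of the iterated logarithm -/

/-- Only countably many constants are tested, so the exceptional null sets can be united. Values in
`EReal` spare any boundedness condition on the upper limit. -/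
lemma limsup_div_eq_one {α : Type*} {l : Filter α} {f g h : α → ℝ}
    (hg : ∀ᶠ x in l, 0 < g x) (hh : Tendsto (fun x => h x / g x) l (𝓝 1))
    (hup : ∀ m : ℕ, ∀ᶠ x in l, f x ≤ (1 + 1 / ((m : ℝ) + 1)) * g x)
    (hlow : ∀ m : ℕ, ∃ᶠ x in l, (1 - 1 / ((m : ℝ) + 1)) * g x ≤ f x) :
    limsup (fun x => ((f x / h x : ℝ) : EReal)) l = 1 := by
  have hhpos : ∀ᶠ x in l, 0 < h x := by
    filter_upwards [hg, hh.eventually_const_lt one_pos] with x h1 h2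
    simpa [h1.ne'] using mul_pos h2 h1
  have hz : ∀ z : ℝ, Tendsto (fun x => z * (h x / g x)) l (𝓝 z) := fun z => by
    simpa using hh.const_mul z
  refine le_antisymm (EReal.le_of_forall_lt_iff_le.1 fun z h1z => ?_)
    (EReal.ge_of_forall_gt_iff_ge.1 fun z hz1 => ?_)
  · obtain ⟨m, hm⟩ := exists_nat_one_div_lt (sub_pos.2 (show (1 : ℝ) < z by exact_mod_cast h1z))
    refine limsup_le_of_le (h := ?_)
    filter_upwards [hg, hhpos, hup m,
      (hz z).eventually_const_lt (show 1 + 1 / ((m : ℝ) + 1) < z by linarith)] with x h1 h2 h3 h4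
    rw [← mul_div_assoc, lt_div_iff₀ h1] at h4
    rw [EReal.coe_le_coe_iff, div_le_iff₀ h2]
    linarith
  · obtain ⟨m, hm⟩ := exists_nat_one_div_lt (sub_pos.2 (show z < (1 : ℝ) by exact_mod_cast hz1))
    refine le_limsup_of_frequently_le ?_
    refine ((hlow m).and_eventually (hg.and (hhpos.and ((hz z).eventually_lt_const
      (show z < 1 - 1 / ((m : ℝ) + 1) by linarith))))).mono ?_
    rintro x ⟨h3, h1, h2, h4⟩
    rw [← mul_div_assoc, div_lt_iff₀ h1] at h4
    rw [EReal.coe_le_coe_iff, le_div_iff₀ h2]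
    linarith

section
variable {Ω : Type*} [MeasurableSpace Ω] {P : Measure Ω} [IsProbabilityMeasure P]
  {X : ℕ → Ω → ℝ}

namespace IsRademacher

lemma ae_limsup_eq_one (hX : IsRademacher P X) {v : ℝ → ℝ}
    (hv : Tendsto (fun σ => v σ / (1 / (2 * σ - 1))) (𝓝[>] (1 / 2 : ℝ)) (𝓝 1)) :
    ∀ᵐ ω ∂P, limsup (fun σ : ℝ => ((F X σ ω / lilNorm (v σ) : ℝ) : EReal))
      (𝓝[>] (1 / 2 : ℝ)) = 1 := by
  have hup : ∀ᵐ ω ∂P, ∀ m : ℕ, ∀ᶠ σ in 𝓝[>] (1 / 2 : ℝ),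
      F X σ ω ≤ (1 + 1 / ((m : ℝ) + 1)) * lilNorm (1 / (2 * σ - 1)) :=
    ae_all_iff.2 fun m => hX.ae_eventually_F_le (by simp; positivity)
  have hlow : ∀ᵐ ω ∂P, ∀ m : ℕ, ∃ᶠ σ in 𝓝[>] (1 / 2 : ℝ),
      (1 - 1 / ((m : ℝ) + 1)) * lilNorm (1 / (2 * σ - 1)) ≤ F X σ ω :=
    ae_all_iff.2 fun m => hX.ae_frequently_le_F (by simp; positivity)
  have hratio := tendsto_lilNorm_div_lilNorm one_pos tendsto_one_div_two_mul_sub_one hv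
  rw [Real.sqrt_one] at hratio
  filter_upwards [hup, hlow] with ω h1 h2
  exact limsup_div_eq_one (eventually_lilNorm_pos tendsto_one_div_two_mul_sub_one) hratio h1 h2

lemma ae_liminf_eq_neg_one (hX : IsRademacher P X) {v : ℝ → ℝ}
    (hv : Tendsto (fun σ => v σ / (1 / (2 * σ - 1))) (𝓝[>] (1 / 2 : ℝ)) (𝓝 1)) :
    ∀ᵐ ω ∂P, liminf (fun σ : ℝ => ((F X σ ω / lilNorm (v σ) : ℝ) : EReal))
      (𝓝[>] (1 / 2 : ℝ)) = -1 := by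
  filter_upwards [hX.neg.ae_limsup_eq_one hv, hX.ae_tendsto_F, hX.neg.ae_tendsto_F]
    with ω h1 h2 h3
  have h4 : (fun σ : ℝ => ((F (fun n ω => -X n ω) σ ω / lilNorm (v σ) : ℝ) : EReal))
      =ᶠ[𝓝[>] (1 / 2 : ℝ)] -fun σ : ℝ => ((F X σ ω / lilNorm (v σ) : ℝ) : EReal) := by
    filter_upwards [self_mem_nhdsWithin] with σ hσ
    have h5 : F (fun n ω => -X n ω) σ ω = -F X σ ω :=
      tendsto_nhds_unique (h3 σ hσ) ((h2 σ hσ).neg.congr fun N => by simp [wsum])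
    rw [Pi.neg_apply, h5, neg_div, EReal.coe_neg]
  rw [limsup_congr h4, EReal.limsup_neg] at h1
  rw [← h1, neg_neg]

end IsRademacher
end
end RandomDirichlet

theorem theorem1 {Ω : Type*} [MeasurableSpace Ω] (P : Measure Ω) [IsProbabilityMeasure P]
    (X : ℕ → Ω → ℝ) (hX : RandomDirichlet.IsRademacher P X) :
    -- almost surely the series converges at every `σ > 1/2`, with sum `F(σ)`
    (∀ᵐ ω ∂P, ∀ σ : ℝ, 1 / 2 < σ →
      Tendsto (fun N : ℕ => RandomDirichlet.partialSum X N σ ω) atTop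
        (𝓝 (RandomDirichlet.F X σ ω))) ∧
    -- `F(σ)` is square integrable, so that its second moment is meaningful
    (∀ σ : ℝ, 1 / 2 < σ → MemLp (RandomDirichlet.F X σ) 2 P) ∧
    -- `𝔼 F(σ)² ~ 1 / (2σ - 1)` as `σ → 1/2⁺`
    Tendsto (fun σ : ℝ => RandomDirichlet.secondMoment P X σ / (1 / (2 * σ - 1)))
      (𝓝[>] (1 / 2 : ℝ)) (𝓝 1) ∧
    -- the law of the iterated logarithm, limsup and liminf, with either normaliser
    (∀ᵐ ω ∂P,
      limsup (fun σ : ℝ => ((RandomDirichlet.F X σ ω /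
          RandomDirichlet.lilNorm (RandomDirichlet.secondMoment P X σ) : ℝ) : EReal))
        (𝓝[>] (1 / 2 : ℝ)) = 1) ∧
    (∀ᵐ ω ∂P,
      limsup (fun σ : ℝ => ((RandomDirichlet.F X σ ω /
          RandomDirichlet.lilNorm (1 / (2 * σ - 1)) : ℝ) : EReal))
        (𝓝[>] (1 / 2 : ℝ)) = 1) ∧
    (∀ᵐ ω ∂P,
      liminf (fun σ : ℝ => ((RandomDirichlet.F X σ ω /
          RandomDirichlet.lilNorm (RandomDirichlet.secondMoment P X σ) : ℝ) : EReal))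
        (𝓝[>] (1 / 2 : ℝ)) = -1) ∧
    (∀ᵐ ω ∂P,
      liminf (fun σ : ℝ => ((RandomDirichlet.F X σ ω /
          RandomDirichlet.lilNorm (1 / (2 * σ - 1)) : ℝ) : EReal))
        (𝓝[>] (1 / 2 : ℝ)) = -1) := by
  have hself : Tendsto (fun σ : ℝ => 1 / (2 * σ - 1) / (1 / (2 * σ - 1))) (𝓝[>] (1 / 2 : ℝ))
      (𝓝 1) := by
    refine tendsto_const_nhds.congr' ?_
    filter_upwards [RandomDirichlet.tendsto_one_div_two_mul_sub_one.eventually_gt_atTop 0]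
      with σ h
    rw [div_self h.ne']
  refine ⟨?_, fun σ hσ => hX.memLp_F hσ, hX.tendsto_secondMoment,
    hX.ae_limsup_eq_one hX.tendsto_secondMoment, hX.ae_limsup_eq_one hself,
    hX.ae_liminf_eq_neg_one hX.tendsto_secondMoment, hX.ae_liminf_eq_neg_one hself⟩
  simpa only [RandomDirichlet.partialSum_eq_wsum] using hX.ae_tendsto_F
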